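/- **Model.** Let $\mathbb K$ be a field. Costs are numbers of arithmetic operations $+,-,\times,/$ in $\mathbb K$ performed by straight-line programs over $\mathbb K$: such a program starts from its inputs and arbitrary constants of $\mathbb K$ (free of charge), each operation is applied to two available quantities, and a divisor must be nonzero for every value of the inputs. Let $\mathbb K[X]\langle\partial\rangle=\mathbb K\langle X,\partial;\ \partial X=X\partial+1\rangle$ and $\mathbb K[X]\langle\theta\rangle=\mathbb K\langle X,\theta;\ \theta X=X(\theta+1)\rangle$. Multiplication in bidegree $(n,n)$ in the first (resp. second) algebra is the problem of computing, from the coefficients on the monomials $X^i\partial^j$ (resp. $X^i\theta^j$), $0\le i,j\le n$, of two elements, the coefficients of their product on the monomials $X^i\partial^j$ (resp. $X^i\theta^j$), $0\le i,j\le 2n$. Call $F:\mathbb N\to\mathbb N$ *$\kappa$-admissible*, for $\kappa:\mathbb N\to\mathbb N$, if $F(m)/m\le F(n)/n$ whenever $0<m\le n$, and $F(cn)\le\kappa(c)\,F(n)$ for all $c\ge1$ and $n\ge0$. **Theorem.** For every $\kappa:\mathbb N\to\mathbb N$ there is a constant $C>0$ such that the following holds for every field $\mathbb K$, of any characteristic.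 Let $\mathsf M$ be a $\kappa$-admissible function such that, for every $n$, two polynomials of degree at most $n$ in $\mathbb K[X]$ can be multiplied in $\mathsf M(n)$ operations. 1. If $\mathsf C_\partial$ is a $\kappa$-admissible function such that, for every $n$, multiplication in $\mathbb K[X]\langle\partial\rangle$ in bidegree $(n,n)$ can be done in $\mathsf C_\partial(n)$ operations, then, for every $n\ge 0$, multiplication in $\mathbb K[X]\langle\theta\rangle$ in bidegree $(n,n)$ can be done in at most $$C\,\bigl(\mathsf C_\partial(n)+n\,\mathsf M(n)\log n\bigr)$$ operations. 2. If $\mathsf C_\theta$ is a $\kappa$-admissible function such that, for every $n$, multiplication in $\mathbb K[X]\langle\theta\rangle$ in bidegree $(n,n)$ can be done in $\mathsf C_\theta(n)$ operations, then, for every $n\ge 0$, multiplication in $\mathbb K[X]\langle\partial\rangle$ in bidegree $(n,n)$ can be done in at most $$C\,\bigl(\mathsf C_\theta(n)+n\,\mathsf M(n)\log n\bigr)$$ operations. (For $n=0$ the term $n\,\mathsf M(n)\log n$ is read as $0$.) -/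

import Mathlib

/-! ## Straight-line programs over a field, counted by arithmetic operations -/

/-- `g` is obtained by one arithmetic operation from two functions in `S`. The functions are
the values of a program on its input `x : ι → K`. A division is allowed only if
the divisor vanishes on no input. -/
inductive ArithStep {K : Type*} [Field K] {ι : Type*} (S : Set ((ι → K) → K)) :
    ((ι → K) → K) → Prop
  | add {f g : (ι → K) → K} (hf : f ∈ S) (hg : g ∈ S) : ArithStep S (fun x => f x + g x)
  | sub {f g : (ι → K) → K} (hf : f ∈ S) (hg : g ∈ S) : ArithStep S (fun x => f x - g x)
  | mul {f g : (ι → K) → K} (hf : f ∈ S) (hg : g ∈ S) : ArithStep S (fun x => f x * g x)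
  | div {f g : (ι → K) → K} (hf : f ∈ S) (hg : g ∈ S) (h0 : ∀ x, g x ≠ 0) :
      ArithStep S (fun x => f x / g x)

/-- The quantities available at no cost: the input coordinates and the constants of `K`. -/
def freeValues (K : Type*) (ι : Type*) : Set ((ι → K) → K) :=
  {f | (∃ i : ι, f = fun x => x i) ∨ ∃ c : K, f = fun _ => c}

/-- `StraightLine L S`: some straight-line program of `L` operations
`+, -, *, /` on inputs `x : ι → K` has `S` as its set of available values (the free ones and all
intermediate results) when it halts. -/
inductive StraightLine {K : Type*} [Field K] {ι : Type*} : ℕ → Set ((ι → K) → K) → Prop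
  | start : StraightLine 0 (freeValues K ι)
  | step {L : ℕ} {S : Set ((ι → K) → K)} {g : (ι → K) → K}
      (hS : StraightLine L S) (hg : ArithStep S g) : StraightLine (L + 1) (insert g S)

/-- The map `F : K^ι → K^o` is computed by a straight-line program with `L` operations in `K`. -/
def SlpComputes {K : Type*} [Field K] {ι o : Type*} (F : (ι → K) → (o → K)) (L : ℕ) : Prop :=
  ∃ S : Set ((ι → K) → K), StraightLine L S ∧ ∀ k : o, (fun x => F x k) ∈ S

/-! ## The two algebras of differential operators -/

/-- The relation `∂ X = X ∂ + 1`; generator `0` is `X`, generator `1` is `∂`. -/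
inductive DerivRel (K : Type*) [Field K] :
    FreeAlgebra K (Fin 2) → FreeAlgebra K (Fin 2) → Prop
  | comm : DerivRel K (FreeAlgebra.ι K 1 * FreeAlgebra.ι K 0)
      (FreeAlgebra.ι K 0 * FreeAlgebra.ι K 1 + 1)

/-- The relation `θ X = X (θ + 1)`; generator `0` is `X`, generator `1` is `θ`. -/
inductive EulerRel (K : Type*) [Field K] :
    FreeAlgebra K (Fin 2) → FreeAlgebra K (Fin 2) → Prop
  | comm : EulerRel K (FreeAlgebra.ι K 1 * FreeAlgebra.ι K 0)
      (FreeAlgebra.ι K 0 * (FreeAlgebra.ι K 1 + 1))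

/-- `K[X]⟨∂⟩ = K⟨X, ∂ ; ∂ X = X ∂ + 1⟩`. -/
abbrev DerivAlg (K : Type*) [Field K] : Type _ := RingQuot (DerivRel K)

/-- `K[X]⟨θ⟩ = K⟨X, θ ; θ X = X (θ + 1)⟩`. -/
abbrev EulerAlg (K : Type*) [Field K] : Type _ := RingQuot (EulerRel K)

/-- The element `∑ a i j X^i ∂^j` of bidegree at most `(d, r)` of `K[X]⟨∂⟩` with
canonical form `a`. -/
noncomputable def DerivAlg.ofCoeffs (K : Type*) [Field K] {d r : ℕ}
    (a : Fin (d + 1) × Fin (r + 1) → K) : DerivAlg K :=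
  ∑ p : Fin (d + 1) × Fin (r + 1), a p •
    (RingQuot.mkAlgHom K (DerivRel K) (FreeAlgebra.ι K 0) ^ (p.1 : ℕ) *
      RingQuot.mkAlgHom K (DerivRel K) (FreeAlgebra.ι K 1) ^ (p.2 : ℕ))

/-- The element `∑ a i j X^i θ^j` of bidegree at most `(d, r)` of `K[X]⟨θ⟩` with
canonical form `a`. -/
noncomputable def EulerAlg.ofCoeffs (K : Type*) [Field K] {d r : ℕ}
    (a : Fin (d + 1) × Fin (r + 1) → K) : EulerAlg K :=
  ∑ p : Fin (d + 1) × Fin (r + 1), a p •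
    (RingQuot.mkAlgHom K (EulerRel K) (FreeAlgebra.ι K 0) ^ (p.1 : ℕ) *
      RingQuot.mkAlgHom K (EulerRel K) (FreeAlgebra.ι K 1) ^ (p.2 : ℕ))

/-! ## The multiplication problems -/

/-- The input indices of the problem of multiplying two elements of bidegree at most `(n, n)`:
the coefficients of the left factor, then those of the right factor. -/
abbrev OpInput (n : ℕ) : Type :=
  (Fin (n + 1) × Fin (n + 1)) ⊕ (Fin (n + 1) × Fin (n + 1))

/-- The output indices: a product has bidegree at most `(2n, 2n)`. -/
abbrev OpOutput (n : ℕ) : Type := Fin (2 * n + 1) × Fin (2 * n + 1)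

/-- The canonical form of the product of two elements of `K[X]⟨∂⟩` of bidegree at most `(n, n)`,
given in canonical form, can be computed with `L` operations in `K`. -/
def DerivMulIn (K : Type*) [Field K] (n L : ℕ) : Prop :=
  ∃ F : (OpInput n → K) → (OpOutput n → K), SlpComputes F L ∧
    ∀ x, DerivAlg.ofCoeffs K (F x) =
      DerivAlg.ofCoeffs K (fun p => x (Sum.inl p)) * DerivAlg.ofCoeffs K (fun p => x (Sum.inr p))

/-- The canonical form of the product of two elements of `K[X]⟨θ⟩` of bidegree at most `(n, n)`,
given in canonical form, can be computed with `L` operations in `K`. -/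
def EulerMulIn (K : Type*) [Field K] (n L : ℕ) : Prop :=
  ∃ F : (OpInput n → K) → (OpOutput n → K), SlpComputes F L ∧
    ∀ x, EulerAlg.ofCoeffs K (F x) =
      EulerAlg.ofCoeffs K (fun p => x (Sum.inl p)) * EulerAlg.ofCoeffs K (fun p => x (Sum.inr p))

/-- The polynomial of degree at most `d` with coefficients `a`. -/
noncomputable def polyOfCoeffs {K : Type*} [Field K] {d : ℕ} (a : Fin (d + 1) → K) :
    Polynomial K :=
  ∑ i : Fin (d + 1), Polynomial.monomial (i : ℕ) (a i)

/-- Two polynomials of degree at most `n` in `K[X]` can be multiplied with `L` operations. -/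
def PolyMulIn (K : Type*) [Field K] (n L : ℕ) : Prop :=
  ∃ F : ((Fin (n + 1) ⊕ Fin (n + 1)) → K) → (Fin (2 * n + 1) → K), SlpComputes F L ∧
    ∀ x, polyOfCoeffs (F x) =
      polyOfCoeffs (fun i => x (Sum.inl i)) * polyOfCoeffs (fun i => x (Sum.inr i))

/-! ## Growth assumptions on cost functions -/

/-- Super-linearity: `F m / m ≤ F n / n` for `0 < m ≤ n`. -/
def SuperLinear (F : ℕ → ℕ) : Prop :=
  ∀ m n : ℕ, 0 < m → m ≤ n → n * F m ≤ m * F n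

/-- `F (c n)` is in `O(F n)` for every positive constant `c`, the implied constant being `κ c`. -/
def ScalesBy (κ : ℕ → ℕ) (F : ℕ → ℕ) : Prop :=
  ∀ c : ℕ, 0 < c → ∀ n : ℕ, F (c * n) ≤ κ c * F n

/-! ## Combining straight-line programs -/

section Slp

variable {K : Type*} [Field K]

/-! Put `θ = X∂`. Then `θ(θ-1)⋯(θ-k+1) = X^k ∂^k`, so a row `X^i p(θ)` becomes `∑ e_k X^(i+k) ∂^k`,
where the `e_k` are the coordinates of `p` in the Newton basis at the nodes `0, 1, 2, …`. Changing
algebras is thus a change of polynomial basis in each row, followed by a shift of indices that costs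
nothing.

The change of basis is done by divide and conquer (`newtonSum_computes`,
`exists_newtonSum_eq_truncPoly`) in `O(M(n) log n)` operations, hence `O(n M(n) log n)` for `O(n)`
rows. It divides only by monic polynomials, never by differences of nodes, so nodes that coincide in
positive characteristic do no harm.

To multiply in `θ` (`EulerMulIn.of_derivMulIn`), map both factors by `θ ↦ X∂`, multiply there and
convert back. For the converse (`DerivMulIn.of_eulerMulIn`), `∂` itself is not in the image of this
map, but `X^n a` is whenever `a` has order at most `n` in `∂`. Moreover `p(θ) X^n = X^n p(θ+n)`, so
Newton nodes starting at `n` give an operator `A` with `A X^n = X^(2n) a`. Its product with `X^n b`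
is `X^(2n) a b`, and `X^(2n)` is removed by an index shift.

Correctness rests on uniqueness of coefficients in `K[X]⟨∂⟩` (`DerivAlg.coeff_bform`); in `K[X]⟨θ⟩`
the existence of a canonical form for the product is enough. The cases `n < 2`, where the
logarithmic term vanishes, use the structure constants in at most 432 operations. -/

theorem StraightLine.freeValues_subset {ι : Type*} {L : ℕ} {S : Set ((ι → K) → K)}
    (h : StraightLine L S) : freeValues K ι ⊆ S := by
  induction h with
  | start => exact subset_rfl
  | step _ _ ih => exact ih.trans (Set.subset_insert _ _)

/-- A program on inputs `ι'` can be run after a program whose values include all its inputs. -/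
theorem StraightLine.append {ι ι' : Type*} {L L' : ℕ} {S : Set ((ι → K) → K)}
    {S' : Set ((ι' → K) → K)} (h : StraightLine L S) (h' : StraightLine L' S')
    (u : (ι → K) → (ι' → K)) (hu : ∀ i, (fun x => u x i) ∈ S) :
    ∃ T, StraightLine (L + L') T ∧ S ⊆ T ∧ ∀ f ∈ S', (fun x => f (u x)) ∈ T := by
  induction h' with
  | start =>
    refine ⟨S, h, subset_rfl, ?_⟩
    rintro f (⟨i, rfl⟩ | ⟨c, rfl⟩)
    · exact hu i
    · exact h.freeValues_subset (Or.inr ⟨c, rfl⟩)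
  | @step L' S' g _ hg ih =>
    obtain ⟨T, hT, hST, hf⟩ := ih
    refine ⟨insert (fun x => g (u x)) T, .step hT ?_, hST.trans (Set.subset_insert _ _), ?_⟩
    · cases hg with
      | add h1 h2 => exact .add (hf _ h1) (hf _ h2)
      | sub h1 h2 => exact .sub (hf _ h1) (hf _ h2)
      | mul h1 h2 => exact .mul (hf _ h1) (hf _ h2)
      | div h1 h2 h0 => exact .div (hf _ h1) (hf _ h2) fun x => h0 (u x)
    · rintro f (rfl | hfS)
      · exact Set.mem_insert _ _
      · exact Set.mem_insert_of_mem _ (hf f hfS)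

variable {ι ι' o o' : Type*}

theorem SlpComputes.congr {F G : (ι → K) → (o → K)} {L : ℕ} (h : SlpComputes F L)
    (hFG : ∀ x k, G x k = F x k) : SlpComputes G L := by
  obtain rfl : G = F := funext fun x => funext (hFG x)
  exact h

theorem SlpComputes.of_free {F : (ι → K) → (o → K)}
    (h : ∀ k, (∃ i, ∀ x, F x k = x i) ∨ ∃ c, ∀ x, F x k = c) : SlpComputes F 0 :=
  ⟨_, .start, fun k => (h k).imp (fun ⟨i, hi⟩ => ⟨i, funext hi⟩) fun ⟨c, hc⟩ => ⟨c, funext hc⟩⟩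

theorem SlpComputes.reindex (e : o → ι) :
    SlpComputes (fun (x : ι → K) k => x (e k)) 0 :=
  .of_free fun k => Or.inl ⟨e k, fun _ => rfl⟩

theorem SlpComputes.comp {F : (ι' → K) → (o → K)} {G : (ι → K) → (ι' → K)} {L L' : ℕ}
    (hF : SlpComputes F L') (hG : SlpComputes G L) :
    SlpComputes (fun x => F (G x)) (L + L') := by
  obtain ⟨S, hS, hGS⟩ := hG
  obtain ⟨S', hS', hFS⟩ := hF
  obtain ⟨T, hT, -, h⟩ := hS.append hS' G hGS
  exact ⟨T, hT, fun k => h _ (hFS k)⟩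

theorem SlpComputes.sumElim {F : (ι → K) → (o → K)} {G : (ι → K) → (o' → K)} {L L' : ℕ}
    (hF : SlpComputes F L) (hG : SlpComputes G L') :
    SlpComputes (fun x => Sum.elim (F x) (G x)) (L + L') := by
  obtain ⟨S, hS, hFS⟩ := hF
  obtain ⟨S', hS', hGS⟩ := hG
  obtain ⟨T, hT, hST, h⟩ := hS.append hS' id
    fun i => hS.freeValues_subset (Or.inl ⟨i, rfl⟩)
  refine ⟨T, hT, ?_⟩
  rintro (k | k)
  · exact hST (hFS k)
  · exact h _ (hGS k)

/-- Outputs may be permuted, repeated, dropped or padded by constants. -/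
theorem SlpComputes.select {F : (ι → K) → (o → K)} {L : ℕ} (hF : SlpComputes F L)
    (G : (ι → K) → (o' → K))
    (h : ∀ k, (∃ i, ∀ x, G x k = F x i) ∨ ∃ c, ∀ x, G x k = c) : SlpComputes G L := by
  obtain ⟨S, hS, hFS⟩ := hF
  refine ⟨S, hS, fun k => ?_⟩
  rcases h k with ⟨i, hi⟩ | ⟨c, hc⟩
  · rw [funext hi]; exact hFS i
  · rw [funext hc]; exact hS.freeValues_subset (Or.inr ⟨c, rfl⟩)

/-- Inputs may be permuted, repeated or specialised to constants. -/
theorem SlpComputes.precomp {F : (ι' → K) → (o → K)} {L : ℕ} (hF : SlpComputes F L)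
    (G : (ι → K) → (ι' → K))
    (h : ∀ k, (∃ i, ∀ x, G x k = x i) ∨ ∃ c, ∀ x, G x k = c) :
    SlpComputes (fun x => F (G x)) L := by
  simpa using hF.comp (SlpComputes.of_free h)

theorem SlpComputes.mono {F : (ι → K) → (o → K)} {L L' : ℕ} (hF : SlpComputes F L)
    (hL : L ≤ L') : SlpComputes F L' := by
  induction hL with
  | refl => exact hF
  | step _ ih =>
    obtain ⟨S, hS, hFS⟩ := ih
    have h0 : (fun _ : ι → K => (0 : K)) ∈ S := hS.freeValues_subset (Or.inr ⟨0, rfl⟩)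
    exact ⟨_, hS.step (.add h0 h0), fun k => Set.mem_insert_of_mem _ (hFS k)⟩

/-- Independent programs, all but finitely many of which are free. -/
theorem SlpComputes.family {I : Type*} {F : I → (ι → K) → (o → K)} {L : ℕ} (s : Finset I)
    (h : ∀ i ∈ s, SlpComputes (F i) L)
    (h0 : ∀ i ∉ s, ∀ k, (∃ j, ∀ x, F i x k = x j) ∨ ∃ c, ∀ x, F i x k = c) :
    SlpComputes (fun x (p : I × o) => F p.1 x p.2) (s.card * L) := by
  classical
  have key : ∀ t ⊆ s, ∃ S, StraightLine (t.card * L) S ∧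
      ∀ i ∈ t, ∀ k, (fun x => F i x k) ∈ S := by
    intro t
    induction t using Finset.induction_on with
    | empty => exact fun _ => ⟨_, by simpa using StraightLine.start, by simp⟩
    | insert a t ha ih =>
      intro hts
      obtain ⟨S, hS, hSt⟩ := ih ((Finset.subset_insert _ _).trans hts)
      obtain ⟨S', hS', hSa⟩ := h a (hts (Finset.mem_insert_self _ _))
      obtain ⟨T, hT, hST, hf⟩ := hS.append hS' id
        fun i => hS.freeValues_subset (Or.inl ⟨i, rfl⟩)
      refine ⟨T, by rw [Finset.card_insert_of_notMem ha, add_mul, one_mul]; exact hT, ?_⟩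
      intro i hi k
      rcases Finset.mem_insert.1 hi with rfl | hi
      · exact hf _ (hSa k)
      · exact hST (hSt i hi k)
  obtain ⟨S, hS, hSs⟩ := key s subset_rfl
  refine ⟨S, hS, fun ⟨i, k⟩ => ?_⟩
  by_cases hi : i ∈ s
  · exact hSs i hi k
  · refine hS.freeValues_subset ?_
    exact (h0 i hi k).imp (fun ⟨j, hj⟩ => ⟨j, funext hj⟩) fun ⟨c, hc⟩ => ⟨c, funext hc⟩

/-- Output by output, with all but finitely many outputs free. -/
theorem SlpComputes.of_finset {F : (ι → K) → (o → K)} {L : ℕ} (s : Finset o)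
    (h : ∀ k ∈ s, SlpComputes (fun x (_ : Unit) => F x k) L)
    (h0 : ∀ k ∉ s, (∃ j, ∀ x, F x k = x j) ∨ ∃ c, ∀ x, F x k = c) :
    SlpComputes F (s.card * L) :=
  (SlpComputes.family (F := fun k x (_ : Unit) => F x k) s h fun k hk _ => h0 k hk).select F
    fun k => Or.inl ⟨(k, ()), fun _ => rfl⟩

theorem SlpComputes.input_add (i j : ι) :
    SlpComputes (fun (x : ι → K) (_ : Unit) => x i + x j) 1 :=
  ⟨_, .step .start (.add (Or.inl ⟨i, rfl⟩) (Or.inl ⟨j, rfl⟩)), fun _ => Set.mem_insert _ _⟩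

theorem SlpComputes.input_sub (i j : ι) :
    SlpComputes (fun (x : ι → K) (_ : Unit) => x i - x j) 1 :=
  ⟨_, .step .start (.sub (Or.inl ⟨i, rfl⟩) (Or.inl ⟨j, rfl⟩)), fun _ => Set.mem_insert _ _⟩

theorem SlpComputes.const_mul_mul (c : K) (i j : ι) :
    SlpComputes (fun (x : ι → K) (_ : Unit) => c * (x i * x j)) 2 :=
  ⟨_, .step (.step .start (.mul (Or.inl ⟨i, rfl⟩) (Or.inl ⟨j, rfl⟩)))
    (.mul (Set.mem_insert_of_mem _ (Or.inr ⟨c, rfl⟩)) (Set.mem_insert _ _)),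
    fun _ => Set.mem_insert _ _⟩

theorem SlpComputes.add {f g : (ι → K) → K} {L L' : ℕ}
    (hf : SlpComputes (fun x (_ : Unit) => f x) L)
    (hg : SlpComputes (fun x (_ : Unit) => g x) L') :
    SlpComputes (fun x (_ : Unit) => f x + g x) (L + L' + 1) :=
  (SlpComputes.input_add (Sum.inl ()) (Sum.inr ())).comp (hf.sumElim hg)

theorem SlpComputes.sum {I : Type*} {f : I → (ι → K) → K} {L : ℕ} (s : Finset I)
    (hf : ∀ i ∈ s, SlpComputes (fun x (_ : Unit) => f i x) L) :
    SlpComputes (fun x (_ : Unit) => ∑ i ∈ s, f i x) (s.card * (L + 1)) := by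
  classical
  induction s using Finset.induction_on with
  | empty => simpa using SlpComputes.of_free fun _ => Or.inr ⟨0, fun _ => rfl⟩
  | insert a t ha ih =>
    have := (hf a (Finset.mem_insert_self _ _)).add
      (ih fun i hi => hf i (Finset.mem_insert_of_mem hi))
    refine (this.congr fun x _ => Finset.sum_insert ha).mono (le_of_eq ?_)
    rw [Finset.card_insert_of_notMem ha]; ring

/-- A bilinear map between coordinate spaces, computed monomial by monomial. -/
theorem SlpComputes.bilinear [Fintype ι] [Fintype ι'] [Fintype o] (s : ι → ι' → o → K) :
    SlpComputes (fun (x : ι ⊕ ι' → K) k => ∑ p : ι × ι',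
      s p.1 p.2 k * (x (Sum.inl p.1) * x (Sum.inr p.2)))
      (Fintype.card o * (Fintype.card (ι × ι') * 3)) :=
  .of_finset Finset.univ
    (fun _ _ => SlpComputes.sum _ fun _ _ => .const_mul_mul _ _ _)
    fun k hk => absurd (Finset.mem_univ k) hk

/-- A program without operations cannot multiply two of its inputs. -/
theorem SlpComputes.pos_of_mul {F : (ι → K) → (o → K)} {L : ℕ} (hF : SlpComputes F L)
    [DecidableEq ι] {p q : ι} (k : o)
    (h : ∀ a b, F (Pi.single p a + Pi.single q b) k = a * b) : 0 < L := by
  rcases Nat.eq_zero_or_pos L with rfl | hL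
  · exfalso
    obtain ⟨S, hS, hFS⟩ := hF
    cases hS
    rcases hFS k with ⟨i, hi⟩ | ⟨c, hc⟩
    · have hi' : ∀ a b : K, (Pi.single p a + Pi.single q b : ι → K) i = a * b := fun a b =>
        (congrFun hi _).symm.trans (h a b)
      have h10 := hi' 1 0
      have h01 := hi' 0 1
      have h11 := hi' 1 1
      simp only [Pi.add_apply, Pi.single_apply] at h10 h01 h11
      split_ifs at h10 h01 h11 <;> simp_all
    · have h0 := (congrFun hc _).symm.trans (h 0 0)
      have h1 := (congrFun hc _).symm.trans (h 1 1)
      simp at h0 h1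
      exact one_ne_zero (h1.symm.trans h0)
  · exact hL

end Slp

/-! ## Fast conversions between the monomial basis and Newton bases -/

section Newton

open Polynomial

variable {K : Type*} [Field K]

/-- The polynomial `∑ u i X^i`, `i < n`. -/
noncomputable def truncPoly (n : ℕ) (u : ℕ → K) : K[X] := ∑ i ∈ Finset.range n, C (u i) * X ^ i

theorem coeff_truncPoly (n : ℕ) (u : ℕ → K) (k : ℕ) :
    (truncPoly n u).coeff k = if k < n then u k else 0 := by
  simp [truncPoly, coeff_X_pow, Finset.sum_ite_eq]

theorem truncPoly_degree_lt (n : ℕ) (u : ℕ → K) : (truncPoly n u).degree < n := by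
  rw [degree_lt_iff_coeff_zero]
  intro k hk
  rw [coeff_truncPoly, if_neg (by omega)]

theorem truncPoly_coeff {n : ℕ} {f : K[X]} (hf : f.degree < n) :
    truncPoly n (fun i => f.coeff i) = f := by
  ext k
  rw [coeff_truncPoly]
  split_ifs with h
  · rfl
  · exact ((degree_lt_iff_coeff_zero _ _).1 hf k (by omega)).symm

theorem truncPoly_add_index (m n : ℕ) (u : ℕ → K) :
    truncPoly (m + n) u = truncPoly m u + X ^ m * truncPoly n (fun i => u (m + i)) := by
  rw [truncPoly, Finset.sum_range_add, truncPoly, truncPoly, Finset.mul_sum]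
  congr 1
  refine Finset.sum_congr rfl fun i _ => ?_
  rw [pow_add]; ring

/-- The Newton polynomial `∏ (X - p l)`, `l < k`. -/
noncomputable def newtonPoly (p : ℕ → K) (k : ℕ) : K[X] := ∏ l ∈ Finset.range k, (X - C (p l))

theorem newtonPoly_monic (p : ℕ → K) (k : ℕ) : (newtonPoly p k).Monic :=
  monic_prod_of_monic _ _ fun _ _ => monic_X_sub_C _

theorem newtonPoly_degree (p : ℕ → K) (k : ℕ) : (newtonPoly p k).degree = k := by
  simp [newtonPoly, degree_prod]

theorem newtonPoly_succ (p : ℕ → K) (k : ℕ) :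
    newtonPoly p (k + 1) = newtonPoly p k * (X - C (p k)) := Finset.prod_range_succ _ _

theorem newtonPoly_add (p : ℕ → K) (m k : ℕ) :
    newtonPoly p (m + k) = newtonPoly p m * newtonPoly (fun i => p (m + i)) k :=
  Finset.prod_range_add _ _ _

/-- The polynomial with coordinates `e k`, `k < n`, in the Newton basis at `p`. -/
noncomputable def newtonSum (p : ℕ → K) (n : ℕ) (e : ℕ → K) : K[X] :=
  ∑ k ∈ Finset.range n, C (e k) * newtonPoly p k

theorem newtonSum_add_index (p : ℕ → K) (m n : ℕ) (e : ℕ → K) :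
    newtonSum p (m + n) e = newtonSum p m e +
      newtonPoly p m * newtonSum (fun i => p (m + i)) n (fun i => e (m + i)) := by
  rw [newtonSum, Finset.sum_range_add, newtonSum, newtonSum, Finset.mul_sum]
  congr 1
  refine Finset.sum_congr rfl fun i _ => ?_
  rw [newtonPoly_add]; ring

theorem newtonSum_degree_lt (p : ℕ → K) (n : ℕ) (e : ℕ → K) : (newtonSum p n e).degree < n := by
  refine (degree_sum_le _ _).trans_lt ((Finset.sup_lt_iff (WithBot.bot_lt_coe n)).2 fun k hk => ?_)
  rw [degree_mul, newtonPoly_degree]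
  refine (add_le_add degree_C_le le_rfl).trans_lt ?_
  rw [zero_add]
  exact WithBot.coe_lt_coe.2 (Finset.mem_range.1 hk)

theorem newtonSum_congr (p : ℕ → K) {n : ℕ} {e e' : ℕ → K} (h : ∀ i < n, e i = e' i) :
    newtonSum p n e = newtonSum p n e' :=
  Finset.sum_congr rfl fun i hi => by rw [h i (Finset.mem_range.1 hi)]

theorem truncPoly_congr {n : ℕ} {e e' : ℕ → K} (h : ∀ i < n, e i = e' i) :
    truncPoly n e = truncPoly n e' :=
  Finset.sum_congr rfl fun i hi => by rw [h i (Finset.mem_range.1 hi)]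

/-- Barrett's division: the quotient by a monic `g` of degree `m` of `f0 + X^m f1`, where `f1` has
degree less than `m`, is read off the product of `f1` by a polynomial that depends only on `g`. -/
theorem barrett_division {g f1 : K[X]} {m : ℕ} (hg : g.Monic) (hgm : g.degree = m)
    (hf1 : f1.degree < m) :
    (X ^ m * f1 - g * truncPoly m (fun i => (f1 * (X ^ (2 * m) /ₘ g)).coeff (m + i))).degree
      < (m : WithBot ℕ) := by
  have hgn : g.natDegree = m := natDegree_eq_of_degree_eq_some hgm
  set h := X ^ (2 * m) /ₘ g with hh
  set s := X ^ (2 * m) %ₘ g with hs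
  have hdiv : s + g * h = X ^ (2 * m) := modByMonic_add_div _ _
  have hsdeg : s.degree < m := hgm ▸ degree_modByMonic_lt _ hg
  have hhdeg : h.natDegree ≤ m := by
    rw [hh, natDegree_divByMonic _ hg, natDegree_X_pow, hgn]; omega
  set q := truncPoly m (fun i => (f1 * h).coeff (m + i)) with hq
  set r := truncPoly m (fun i => (f1 * h).coeff i) with hr
  have hprod : f1 * h = r + X ^ m * q := by
    rw [hr, hq, ← truncPoly_add_index, truncPoly_coeff]
    rcases eq_or_ne (f1 * h) 0 with h0 | h0
    · rw [h0, degree_zero]; exact WithBot.bot_lt_coe _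
    · rw [degree_eq_natDegree h0]
      have h1 : f1 ≠ 0 := left_ne_zero_of_mul h0
      have := natDegree_mul_le (p := f1) (q := h)
      have := (natDegree_lt_iff_degree_lt h1).2 hf1
      exact_mod_cast (by omega : (f1 * h).natDegree < m + m)
  -- After multiplication by `X^m` both divisions can be substituted: `X^(2m) = s + g h` and `f1 h =
  -- r + X^m q`. The right side has degree below `2m` because `s` and `r` have degree below `m`.
  have hmain : X ^ m * (X ^ m * f1 - g * q) = f1 * s + g * r := by
    have e1 : X ^ (2 * m) = (X : K[X]) ^ m * X ^ m := by rw [two_mul, pow_add]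
    linear_combination f1 * (e1.symm.trans hdiv.symm) + g * hprod
  have hrdeg : r.degree < m := truncPoly_degree_lt _ _
  have hbound : (f1 * s + g * r).degree < ((2 * m : ℕ) : WithBot ℕ) := by
    refine (degree_add_le _ _).trans_lt (max_lt ?_ ?_)
    · rcases eq_or_ne (f1 * s) 0 with h0 | h0
      · rw [h0, degree_zero]; exact WithBot.bot_lt_coe _
      · rw [degree_eq_natDegree h0, natDegree_mul (left_ne_zero_of_mul h0) (right_ne_zero_of_mul h0)]
        have := (natDegree_lt_iff_degree_lt (left_ne_zero_of_mul h0)).2 hf1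
        have := (natDegree_lt_iff_degree_lt (right_ne_zero_of_mul h0)).2 hsdeg
        exact_mod_cast (by omega)
    · rcases eq_or_ne (g * r) 0 with h0 | h0
      · rw [h0, degree_zero]; exact WithBot.bot_lt_coe _
      · rw [degree_eq_natDegree h0, natDegree_mul (left_ne_zero_of_mul h0) (right_ne_zero_of_mul h0)]
        have := (natDegree_lt_iff_degree_lt (right_ne_zero_of_mul h0)).2 hrdeg
        exact_mod_cast (by omega)
  rw [degree_lt_iff_coeff_zero]
  intro k hk
  rw [← coeff_X_pow_mul (X ^ m * f1 - g * q) m k, hmain]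
  exact (degree_lt_iff_coeff_zero _ _).1 hbound (k + m) (by omega)

/-! ### Multiplication by a fixed polynomial, and the growth of costs. -/

theorem polyOfCoeffs_eq_truncPoly {d : ℕ} (u : ℕ → K) :
    polyOfCoeffs (fun i : Fin (d + 1) => u i) = truncPoly (d + 1) u := by
  rw [polyOfCoeffs, truncPoly, Finset.sum_range]
  simp [C_mul_X_pow_eq_monomial]

theorem coeff_polyOfCoeffs {d : ℕ} (a : Fin (d + 1) → K) (k : Fin (d + 1)) :
    (polyOfCoeffs a).coeff k = a k := by
  simp [polyOfCoeffs, coeff_monomial, Fin.val_inj]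

/-- Multiplication by a fixed polynomial. -/
theorem PolyMulIn.mul_const {n L : ℕ} (h : PolyMulIn K n L) {g : K[X]} (hg : g.degree ≤ n) :
    SlpComputes (fun (u : ℕ → K) k => (truncPoly (n + 1) u * g).coeff k) L := by
  obtain ⟨F, hF, hmul⟩ := h
  have hg' : g.degree < (n + 1 : ℕ) := hg.trans_lt (by exact_mod_cast Nat.lt_succ_self n)
  let G : (ℕ → K) → (Fin (n + 1) ⊕ Fin (n + 1) → K) :=
    fun u => Sum.elim (fun i => u i) (fun i => g.coeff i)
  have hG : ∀ k, (∃ i, ∀ x, G x k = x i) ∨ ∃ c, ∀ x, G x k = c := by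
    rintro (k | k)
    · exact Or.inl ⟨k, fun _ => rfl⟩
    · exact Or.inr ⟨g.coeff k, fun _ => rfl⟩
  have key : ∀ u : ℕ → K, truncPoly (n + 1) u * g = polyOfCoeffs (F (G u)) := by
    intro u
    rw [hmul, ← truncPoly_coeff hg', ← polyOfCoeffs_eq_truncPoly, ← polyOfCoeffs_eq_truncPoly]
    rfl
  refine (hF.precomp G hG).select _ fun k => ?_
  by_cases hk : k < 2 * n + 1
  · exact Or.inl ⟨⟨k, hk⟩, fun u => by rw [key]; exact coeff_polyOfCoeffs _ ⟨k, hk⟩⟩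
  · refine Or.inr ⟨0, fun u => ?_⟩
    rw [key, polyOfCoeffs, finsetSum_coeff]
    exact Finset.sum_eq_zero fun i _ => coeff_monomial_of_ne _ (by omega)

/-- A factor of degree below `m` times a fixed one of degree at most `m` fits a multiplication of
size `m`, so a conversion of size `2m` only needs `M m`. The coefficients of the fixed factor are
free constants of the program. -/
theorem PolyMulIn.mul_const_of_lt {m L : ℕ} (h : PolyMulIn K m L) {g : K[X]} (hg : g.degree ≤ m) :
    SlpComputes (fun (u : ℕ → K) k => (truncPoly m u * g).coeff k) L := by
  have h1 := (h.mul_const hg).precomp (fun (u : ℕ → K) i => if i < m then u i else 0) fun k => by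
    by_cases hk : k < m
    · exact Or.inl ⟨k, fun x => if_pos hk⟩
    · exact Or.inr ⟨0, fun x => if_neg hk⟩
  refine h1.congr fun u k => ?_
  congr 2
  ext i
  simp only [coeff_truncPoly]
  split_ifs <;> first | rfl | omega

theorem PolyMulIn.pos {n L : ℕ} (h : PolyMulIn K n L) : 0 < L := by
  classical
  obtain ⟨F, hF, hmul⟩ := h
  refine hF.pos_of_mul (p := Sum.inl 0) (q := Sum.inr 0) 0 fun a b => ?_
  have := congrArg (coeff · 0) (hmul (Pi.single (Sum.inl 0) a + Pi.single (Sum.inr 0) b))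
  simp only [mul_coeff_zero] at this
  refine (coeff_polyOfCoeffs _ (0 : Fin (2 * n + 1))).symm.trans (this.trans ?_)
  congr 1
  · refine (coeff_polyOfCoeffs _ (0 : Fin (n + 1))).trans ?_
    simp
  · refine (coeff_polyOfCoeffs _ (0 : Fin (n + 1))).trans ?_
    simp

theorem SuperLinear.le_of_pos {F : ℕ → ℕ} (hF : SuperLinear F) (h1 : 0 < F 1) (n : ℕ) :
    n ≤ F n := by
  rcases Nat.eq_zero_or_pos n with rfl | hn
  · exact Nat.zero_le _
  · have := hF 1 n one_pos hn
    nlinarith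

theorem SuperLinear.mono {F : ℕ → ℕ} (hF : SuperLinear F) {m n : ℕ} (hm : 0 < m) (hmn : m ≤ n) :
    F m ≤ F n :=
  Nat.le_of_mul_le_mul_left ((hF m n hm hmn).trans (Nat.mul_le_mul_right _ hmn)) (hm.trans_le hmn)

theorem SuperLinear.two_mul_le {F : ℕ → ℕ} (hF : SuperLinear F) {m : ℕ} (hm : 0 < m) :
    2 * F m ≤ F (2 * m) := by
  have := hF m (2 * m) hm (by omega)
  exact Nat.le_of_mul_le_mul_left (by linarith : m * (2 * F m) ≤ m * F (2 * m)) hm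

/-- The coordinatewise sum of the first `n` entries of two vectors. -/
theorem SlpComputes.vector_add (n : ℕ) :
    SlpComputes (fun (x : ℕ ⊕ ℕ → K) (k : ℕ) =>
      if k < n then x (Sum.inl k) + x (Sum.inr k) else 0) n := by
  have := SlpComputes.of_finset (F := fun (x : ℕ ⊕ ℕ → K) (k : ℕ) =>
      if k < n then x (Sum.inl k) + x (Sum.inr k) else 0) (L := 1) (Finset.range n)
    (fun k hk => (SlpComputes.input_add (Sum.inl k) (Sum.inr k)).congr fun x _ =>
      if_pos (Finset.mem_range.1 hk))
    fun k hk => Or.inr ⟨0, fun x => if_neg (by simpa using hk)⟩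
  simpa using this

theorem SlpComputes.vector_sub (n : ℕ) :
    SlpComputes (fun (x : ℕ ⊕ ℕ → K) (k : ℕ) =>
      if k < n then x (Sum.inl k) - x (Sum.inr k) else 0) n := by
  have := SlpComputes.of_finset (F := fun (x : ℕ ⊕ ℕ → K) (k : ℕ) =>
      if k < n then x (Sum.inl k) - x (Sum.inr k) else 0) (L := 1) (Finset.range n)
    (fun k hk => (SlpComputes.input_sub (Sum.inl k) (Sum.inr k)).congr fun x _ =>
      if_pos (Finset.mem_range.1 hk))
    fun k hk => Or.inr ⟨0, fun x => if_neg (by simpa using hk)⟩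
  simpa using this

/-- The recurrence for halving: two half-size conversions, at most two products, and linearly many
additions. The linear term is absorbed because `M` is positive at `1` and superlinear, which gives
`n ≤ M n`. -/
theorem conversion_cost_step {M : ℕ → ℕ} (hM : ∀ n, PolyMulIn K n (M n)) (hS : SuperLinear M)
    (t : ℕ) : 2 * (3 * t * M (2 ^ t)) + 2 * M (2 ^ t) + 2 * 2 ^ t ≤
      3 * (t + 1) * M (2 ^ (t + 1)) := by
  have h1 := hS.le_of_pos (hM 1).pos (2 ^ t)
  have h2 := hS.two_mul_le (m := 2 ^ t) (by positivity)
  rw [← pow_succ'] at h2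
  nlinarith

/-- From a Newton basis to the monomial basis. -/
theorem newtonSum_computes {M : ℕ → ℕ} (hM : ∀ n, PolyMulIn K n (M n)) (hS : SuperLinear M)
    (t : ℕ) (p : ℕ → K) :
    SlpComputes (fun (e : ℕ → K) k => (newtonSum p (2 ^ t) e).coeff k) (3 * t * M (2 ^ t)) := by
  induction t generalizing p with
  | zero =>
    refine (SlpComputes.of_free fun k => ?_).mono (Nat.zero_le _)
    simp only [newtonSum, newtonPoly, pow_zero, Finset.range_one, Finset.sum_singleton,
      Finset.range_zero, Finset.prod_empty, mul_one, coeff_C]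
    by_cases hk : k = 0
    · exact Or.inl ⟨0, fun _ => if_pos hk⟩
    · exact Or.inr ⟨0, fun _ => if_neg hk⟩
  | succ t ih =>
    set m := 2 ^ t with hm
    have h2m : 2 ^ (t + 1) = m + m := by rw [pow_succ, hm]; ring
    have hlow := ih p
    have hhigh := (ih fun i => p (m + i)).precomp (fun (e : ℕ → K) i => e (m + i))
      fun k => Or.inl ⟨m + k, fun _ => rfl⟩
    -- The upper Newton coordinates describe a polynomial at the shifted nodes, to be multiplied by
    -- the Newton polynomial of the first `m` nodes.
    have hmul := ((hM m).mul_const_of_lt (g := newtonPoly p m) (newtonPoly_degree p m).le).comp hhigh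
    have hall := (SlpComputes.vector_add (m + m)).comp (hlow.sumElim hmul)
    refine (hall.congr fun e k => ?_).mono ?_
    · simp only [Sum.elim_inl, Sum.elim_inr, h2m]
      rw [truncPoly_coeff (newtonSum_degree_lt _ _ _), mul_comm, ← coeff_add,
        ← newtonSum_add_index]
      split_ifs with hk
      · rfl
      · exact (degree_lt_iff_coeff_zero _ _).1 (newtonSum_degree_lt p (m + m) e) k (by omega)
    · have := conversion_cost_step hM hS t
      rw [← hm] at this
      omega

/-- From the monomial basis to a Newton basis. -/
theorem exists_newtonSum_eq_truncPoly {M : ℕ → ℕ} (hM : ∀ n, PolyMulIn K n (M n))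
    (hS : SuperLinear M) (t : ℕ) (p : ℕ → K) :
    ∃ E : (ℕ → K) → (ℕ → K), SlpComputes E (3 * t * M (2 ^ t)) ∧
      ∀ u, newtonSum p (2 ^ t) (E u) = truncPoly (2 ^ t) u := by
  induction t generalizing p with
  | zero =>
    refine ⟨fun u => u, (SlpComputes.reindex id).mono (Nat.zero_le _), fun u => ?_⟩
    simp [newtonSum, truncPoly, newtonPoly]
  | succ t ih =>
    set m := 2 ^ t with hm
    have h2m : 2 ^ (t + 1) = m + m := by rw [pow_succ, hm]; ring
    obtain ⟨E₁, hE₁, hE₁u⟩ := ih p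
    obtain ⟨E₂, hE₂, hE₂u⟩ := ih fun i => p (m + i)
    set g := newtonPoly p m with hg
    have hgdeg : g.degree = m := newtonPoly_degree p m
    have hgmon : g.Monic := newtonPoly_monic p m
    set h := X ^ (2 * m) /ₘ g with hh
    have hhdeg : h.degree ≤ m := by
      refine natDegree_le_iff_degree_le.1 ?_
      rw [hh, natDegree_divByMonic _ hgmon, natDegree_X_pow,
        natDegree_eq_of_degree_eq_some hgdeg]
      omega
    -- Barrett quotient by `g`. It uses only the upper half of `u`: the lower half has degree below
    -- that of `g` and does not affect the quotient.
    let Q : (ℕ → K) → (ℕ → K) := fun u i =>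
      (truncPoly m (fun i => u (m + i)) * h).coeff (m + i)
    have hQ : SlpComputes Q (M m) :=
      ((((hM m).mul_const_of_lt hhdeg).precomp (fun (u : ℕ → K) i => u (m + i))
        fun k => Or.inl ⟨m + k, fun _ => rfl⟩)).select Q fun k => Or.inl ⟨m + k, fun _ => rfl⟩
    -- The remainder has degree below `m`, so its first `m` coefficients suffice; the higher ones
    -- cancel.
    let R : (ℕ ⊕ ℕ → K) → (ℕ → K) := fun x k =>
      if k < m then x (Sum.inl k) - (truncPoly m (fun i => x (Sum.inr i)) * g).coeff k else 0
    have hR : SlpComputes R (M m + m) := by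
      have h1 := ((hM m).mul_const_of_lt hgdeg.le).precomp
        (fun (x : ℕ ⊕ ℕ → K) i => x (Sum.inr i)) fun k => Or.inl ⟨Sum.inr k, fun _ => rfl⟩
      have h2 := (SlpComputes.vector_sub m).comp
        ((SlpComputes.reindex (K := K) (Sum.inl : ℕ → ℕ ⊕ ℕ)).sumElim h1)
      exact (h2.mono (by omega)).congr fun x k => rfl
    let E : (ℕ → K) → (ℕ → K) := fun u k =>
      if k < m then E₁ (R (Sum.elim u (Q u))) k else E₂ (Q u) (k - m)
    have hE : SlpComputes E (M m + ((M m + m) + 3 * t * M m + 3 * t * M m)) := by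
      have h1 : SlpComputes (fun u : ℕ → K => Sum.elim u (Q u)) (M m) := by
        simpa using (SlpComputes.reindex (K := K) (id : ℕ → ℕ)).sumElim hQ
      have h2 := (hE₁.comp hR).sumElim (hE₂.precomp (fun (x : ℕ ⊕ ℕ → K) i => x (Sum.inr i))
        fun k => Or.inl ⟨Sum.inr k, fun _ => rfl⟩)
      refine (h2.comp h1).select E fun k => Or.inl ?_
      by_cases hk : k < m
      · exact ⟨Sum.inl k, fun u => if_pos hk⟩
      · exact ⟨Sum.inr (k - m), fun u => if_neg hk⟩
    refine ⟨E, hE.mono ?_, fun u => ?_⟩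
    · have := conversion_cost_step hM hS t
      rw [← hm] at this
      omega
    · have hdiv := barrett_division hgmon hgdeg (truncPoly_degree_lt m fun i => u (m + i))
      rw [← hh] at hdiv
      have e1 : newtonSum p m (E u) = truncPoly m (R (Sum.elim u (Q u))) :=
        (newtonSum_congr p fun i hi => if_pos hi).trans (hE₁u _)
      have e2 : newtonSum (fun i => p (m + i)) m (fun i => E u (m + i)) = truncPoly m (Q u) := by
        refine (newtonSum_congr _ fun i hi => ?_).trans (hE₂u _)
        simp only [E]
        rw [if_neg (by omega), Nat.add_sub_cancel_left]
      rw [h2m, newtonSum_add_index, e1, e2, truncPoly_add_index]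
      have hdeg : (truncPoly (m + m) u - g * truncPoly m (Q u)).degree < m := by
        rw [truncPoly_add_index, add_sub_assoc]
        exact (degree_add_le _ _).trans_lt (max_lt (truncPoly_degree_lt _ _) hdiv)
      have e3 : truncPoly m (R (Sum.elim u (Q u))) =
          truncPoly (m + m) u - g * truncPoly m (Q u) := by
        rw [← truncPoly_coeff hdeg]
        refine truncPoly_congr fun i hi => ?_
        simp only [R, if_pos hi, Sum.elim_inl, Sum.elim_inr, coeff_sub]
        rw [coeff_truncPoly, if_pos (by omega), mul_comm]
      rw [e3, ← truncPoly_add_index]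
      ring

end Newton

/-! ## Canonical forms in algebras generated by two elements -/

section CanonicalForm

open Polynomial

variable {K : Type*} [Field K] {A : Type*} [Ring A] [Algebra K A]

/-- The element `∑ α (i, j) x^i y^j`, `i < d`, `j < r`. -/
def bform (x y : A) (d r : ℕ) (α : ℕ × ℕ → K) : A :=
  ∑ i ∈ Finset.range d, ∑ j ∈ Finset.range r, α (i, j) • (x ^ i * y ^ j)

theorem bform_congr (x y : A) {d r : ℕ} {α β : ℕ × ℕ → K}
    (h : ∀ i < d, ∀ j < r, α (i, j) = β (i, j)) : bform x y d r α = bform x y d r β :=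
  Finset.sum_congr rfl fun i hi => Finset.sum_congr rfl fun j hj => by
    rw [h i (Finset.mem_range.1 hi) j (Finset.mem_range.1 hj)]

theorem bform_eq_sum_aeval (x y : A) (d r : ℕ) (α : ℕ × ℕ → K) :
    bform x y d r α =
      ∑ i ∈ Finset.range d, x ^ i * aeval y (truncPoly r fun j => α (i, j)) := by
  refine Finset.sum_congr rfl fun i _ => ?_
  rw [truncPoly, map_sum, Finset.mul_sum]
  refine Finset.sum_congr rfl fun j _ => ?_
  simp [Algebra.smul_def, ← mul_assoc, (Algebra.commutes (α (i, j)) (x ^ i)).symm]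

theorem bform_fin (x y : A) (d r : ℕ) (α : ℕ × ℕ → K) :
    ∑ p : Fin d × Fin r, α (p.1, p.2) • (x ^ (p.1 : ℕ) * y ^ (p.2 : ℕ)) = bform x y d r α := by
  rw [Fintype.sum_prod_type, bform, Finset.sum_range]
  exact Finset.sum_congr rfl fun i _ => (Finset.sum_range fun j =>
    α (i, j) • (x ^ (i : ℕ) * y ^ j)).symm

/-- Extension by zero of a finite array. -/
def extendArray {d r : ℕ} (a : Fin d × Fin r → K) (p : ℕ × ℕ) : K :=
  if h : p.1 < d ∧ p.2 < r then a (⟨p.1, h.1⟩, ⟨p.2, h.2⟩) else 0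

theorem extendArray_fin {d r : ℕ} (a : Fin d × Fin r → K) (p : Fin d × Fin r) :
    extendArray a (p.1, p.2) = a p := by
  simp [extendArray]

theorem bform_extendArray (x y : A) (d r : ℕ) (a : Fin d × Fin r → K) :
    bform x y d r (extendArray a) =
      ∑ p : Fin d × Fin r, a p • (x ^ (p.1 : ℕ) * y ^ (p.2 : ℕ)) := by
  rw [← bform_fin]
  simp only [extendArray_fin]

/-- Products of canonical forms of bidegree at most `(n, n)` can be computed with `L`
operations. -/
def FormMulIn (K : Type*) [Field K] {A : Type*} [Ring A] [Algebra K A] (x y : A) (n L : ℕ) :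
    Prop :=
  ∃ F : (OpInput n → K) → (OpOutput n → K), SlpComputes F L ∧ ∀ u : OpInput n → K,
    ∑ p, F u p • (x ^ (p.1 : ℕ) * y ^ (p.2 : ℕ)) =
      (∑ p, u (Sum.inl p) • (x ^ (p.1 : ℕ) * y ^ (p.2 : ℕ))) *
        ∑ p, u (Sum.inr p) • (x ^ (p.1 : ℕ) * y ^ (p.2 : ℕ))

/-- Passing to arrays on `ℕ × ℕ` lets the reductions shift indices without carrying bounds. Entries
outside the range are zero, hence free. -/
theorem formMulIn_iff {x y : A} {n L : ℕ} :
    FormMulIn K x y n L ↔ ∃ F : ((ℕ × ℕ) ⊕ (ℕ × ℕ) → K) → (ℕ × ℕ → K), SlpComputes F L ∧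
      ∀ u, bform x y (2 * n + 1) (2 * n + 1) (F u) =
        bform x y (n + 1) (n + 1) (fun p => u (Sum.inl p)) *
          bform x y (n + 1) (n + 1) (fun p => u (Sum.inr p)) := by
  constructor
  · rintro ⟨F, hF, h⟩
    let e : OpInput n → (ℕ × ℕ) ⊕ (ℕ × ℕ) := Sum.map (fun p => (p.1, p.2)) fun p => (p.1, p.2)
    refine ⟨fun u => extendArray (F fun k => u (e k)), ?_, fun u => ?_⟩
    · refine (hF.precomp (fun (u : (ℕ × ℕ) ⊕ (ℕ × ℕ) → K) k => u (e k))
        fun k => Or.inl ⟨e k, fun _ => rfl⟩).select _ fun k => ?_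
      by_cases hk : k.1 < 2 * n + 1 ∧ k.2 < 2 * n + 1
      · exact Or.inl ⟨(⟨k.1, hk.1⟩, ⟨k.2, hk.2⟩), fun u => dif_pos hk⟩
      · exact Or.inr ⟨0, fun u => dif_neg hk⟩
    · rw [bform_extendArray, h, ← bform_fin, ← bform_fin]
      rfl
  · rintro ⟨F, hF, h⟩
    let G : (OpInput n → K) → ((ℕ × ℕ) ⊕ (ℕ × ℕ) → K) := fun u =>
      Sum.elim (extendArray fun p => u (Sum.inl p)) (extendArray fun p => u (Sum.inr p))
    refine ⟨fun u p => F (G u) (p.1, p.2), (hF.precomp G ?_).select _ fun k =>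
      Or.inl ⟨_, fun _ => rfl⟩, fun u => ?_⟩
    · rintro (k | k)
      all_goals by_cases hk : k.1 < n + 1 ∧ k.2 < n + 1
      · exact Or.inl ⟨Sum.inl (⟨k.1, hk.1⟩, ⟨k.2, hk.2⟩), fun u => dif_pos hk⟩
      · exact Or.inr ⟨0, fun u => dif_neg hk⟩
      · exact Or.inl ⟨Sum.inr (⟨k.1, hk.1⟩, ⟨k.2, hk.2⟩), fun u => dif_pos hk⟩
      · exact Or.inr ⟨0, fun u => dif_neg hk⟩
    · rw [bform_fin x y _ _ (F (G u)), h, ← bform_extendArray, ← bform_extendArray]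
      rfl

/-! ### Additivity of bidegrees, and existence of canonical forms of products. -/

/-- The elements of bidegree at most `(d, r)`. -/
def bidegreeLE (K : Type*) [Field K] {A : Type*} [Ring A] [Algebra K A] (x y : A) (d r : ℕ) :
    Submodule K A :=
  Submodule.span K {a | ∃ i j, i ≤ d ∧ j ≤ r ∧ a = x ^ i * y ^ j}

theorem monomial_mem_bidegreeLE {x y : A} {d r i j : ℕ} (hi : i ≤ d) (hj : j ≤ r) :
    x ^ i * y ^ j ∈ bidegreeLE K x y d r :=
  Submodule.subset_span ⟨i, j, hi, hj, rfl⟩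

theorem bidegreeLE_induction {x y : A} {d r : ℕ} {a : A} {S : Submodule K A} (f : A →ₗ[K] A)
    (ha : a ∈ bidegreeLE K x y d r) (h : ∀ i ≤ d, ∀ j ≤ r, f (x ^ i * y ^ j) ∈ S) : f a ∈ S := by
  have : bidegreeLE K x y d r ≤ S.comap f := by
    refine Submodule.span_le.2 ?_
    rintro _ ⟨i, j, hi, hj, rfl⟩
    exact h i hi j hj
  exact this ha

/-- If `y x^i y^j` has the bidegree `(i, j + 1)` then bidegrees are additive. -/
theorem mul_mem_bidegreeLE {x y : A}
    (hxy : ∀ i j, y * (x ^ i * y ^ j) ∈ bidegreeLE K x y i (j + 1))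
    {d r d' r' : ℕ} {a b : A} (ha : a ∈ bidegreeLE K x y d r) (hb : b ∈ bidegreeLE K x y d' r') :
    a * b ∈ bidegreeLE K x y (d + d') (r + r') := by
  have hmono : ∀ {d r d' r' : ℕ}, d ≤ d' → r ≤ r' →
      bidegreeLE K x y d r ≤ bidegreeLE K x y d' r' := by
    intro d r d' r' hd hr
    refine Submodule.span_mono ?_
    rintro _ ⟨i, j, hi, hj, rfl⟩
    exact ⟨i, j, hi.trans hd, hj.trans hr, rfl⟩
  have hpow : ∀ j, y ^ j * b ∈ bidegreeLE K x y d' (r' + j) := by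
    intro j
    induction j with
    | zero => simpa using hb
    | succ j ih =>
      rw [pow_succ', mul_assoc]
      exact bidegreeLE_induction (LinearMap.mulLeft K y) ih fun i hi k hk =>
        hmono hi (by omega) (hxy i k)
  refine bidegreeLE_induction (LinearMap.mulRight K b) ha fun i hi j hj => ?_
  rw [LinearMap.mulRight_apply, mul_assoc]
  refine bidegreeLE_induction (LinearMap.mulLeft K (x ^ i)) (hpow j) fun k hk l hl => ?_
  rw [LinearMap.mulLeft_apply, ← mul_assoc, ← pow_add]
  exact monomial_mem_bidegreeLE (by omega) (by omega)

theorem bform_mem_bidegreeLE (x y : A) (d r : ℕ) (α : ℕ × ℕ → K) :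
    bform x y (d + 1) (r + 1) α ∈ bidegreeLE K x y d r :=
  Submodule.sum_mem _ fun _ hi => Submodule.sum_mem _ fun _ hj =>
    Submodule.smul_mem _ _ (monomial_mem_bidegreeLE (Nat.lt_succ_iff.1 (Finset.mem_range.1 hi))
      (Nat.lt_succ_iff.1 (Finset.mem_range.1 hj)))

theorem exists_fin_of_mem_bidegreeLE {x y : A} {d r : ℕ} {a : A}
    (ha : a ∈ bidegreeLE K x y d r) : ∃ c : Fin (d + 1) × Fin (r + 1) → K,
      a = ∑ p, c p • (x ^ (p.1 : ℕ) * y ^ (p.2 : ℕ)) := by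
  have : bidegreeLE K x y d r ≤ Submodule.span K
      (Set.range fun p : Fin (d + 1) × Fin (r + 1) => x ^ (p.1 : ℕ) * y ^ (p.2 : ℕ)) := by
    refine Submodule.span_mono ?_
    rintro _ ⟨i, j, hi, hj, rfl⟩
    exact ⟨(⟨i, Nat.lt_succ_of_le hi⟩, ⟨j, Nat.lt_succ_of_le hj⟩), rfl⟩
  obtain ⟨c, hc⟩ := (Submodule.mem_span_range_iff_exists_fun K).1 (this ha)
  exact ⟨c, hc.symm⟩

theorem exists_bform_of_mem_bidegreeLE {x y : A} {d r : ℕ} {a : A}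
    (ha : a ∈ bidegreeLE K x y d r) : ∃ α : ℕ × ℕ → K, a = bform x y (d + 1) (r + 1) α := by
  obtain ⟨c, hc⟩ := exists_fin_of_mem_bidegreeLE ha
  exact ⟨extendArray c, hc.trans (bform_extendArray _ _ _ _ _).symm⟩

theorem exists_bform_mul {x y : A}
    (hxy : ∀ i j, y * (x ^ i * y ^ j) ∈ bidegreeLE K x y i (j + 1)) (n : ℕ) (α β : ℕ × ℕ → K) :
    ∃ γ : ℕ × ℕ → K, bform x y (n + 1) (n + 1) α * bform x y (n + 1) (n + 1) β =
      bform x y (2 * n + 1) (2 * n + 1) γ := by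
  have := mul_mem_bidegreeLE hxy (bform_mem_bidegreeLE x y n n α) (bform_mem_bidegreeLE x y n n β)
  rw [← two_mul] at this
  exact exists_bform_of_mem_bidegreeLE this

/-- Multiplication by means of the structure constants. -/
theorem formMulIn_structure_constants {x y : A}
    (hxy : ∀ i j, y * (x ^ i * y ^ j) ∈ bidegreeLE K x y i (j + 1)) (n : ℕ) :
    FormMulIn K x y n ((2 * n + 1) ^ 2 * (3 * (n + 1) ^ 4)) := by
  have h : ∀ p q : Fin (n + 1) × Fin (n + 1), ∃ c : OpOutput n → K,
      (x ^ (p.1 : ℕ) * y ^ (p.2 : ℕ)) * (x ^ (q.1 : ℕ) * y ^ (q.2 : ℕ)) =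
        ∑ k, c k • (x ^ (k.1 : ℕ) * y ^ (k.2 : ℕ)) := fun p q => by
    have := mul_mem_bidegreeLE hxy
      (monomial_mem_bidegreeLE (K := K) (Nat.lt_succ_iff.1 p.1.2) (Nat.lt_succ_iff.1 p.2.2))
      (monomial_mem_bidegreeLE (K := K) (Nat.lt_succ_iff.1 q.1.2) (Nat.lt_succ_iff.1 q.2.2))
    rw [← two_mul] at this
    exact exists_fin_of_mem_bidegreeLE this
  choose s hs using h
  refine ⟨_, (SlpComputes.bilinear s).mono (le_of_eq ?_), fun u => ?_⟩
  · simp only [Fintype.card_prod, Fintype.card_fin]; ring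
  · rw [Finset.sum_mul_sum, ← Finset.sum_product', Finset.univ_product_univ]
    simp only [Finset.sum_smul]
    rw [Finset.sum_comm]
    refine Finset.sum_congr rfl fun p _ => ?_
    rw [smul_mul_smul_comm, hs, Finset.smul_sum]
    refine Finset.sum_congr rfl fun k _ => ?_
    rw [smul_smul, mul_comm]

/-- Multiplication costs at least one operation, if constant terms are well defined. -/
theorem FormMulIn.pos {x y : A} {n L : ℕ} (h : FormMulIn K x y n L) (ev : A →ₗ[K] K)
    (hev : ∀ i j, ev (x ^ i * y ^ j) = if i = 0 ∧ j = 0 then 1 else 0) : 0 < L := by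
  classical
  obtain ⟨F, hF, hmul⟩ := h
  have hone : ev 1 = 1 := by simpa using hev 0 0
  have hev0 : ∀ (m : ℕ) (c : Fin (m + 1) × Fin (m + 1) → K),
      ev (∑ p, c p • (x ^ (p.1 : ℕ) * y ^ (p.2 : ℕ))) = c (0, 0) := fun m c => by
    rw [map_sum, Finset.sum_eq_single (0, 0)]
    · simp [hone]
    · rintro ⟨i, j⟩ - hp
      rw [map_smul, hev, if_neg, smul_zero]
      rintro ⟨hi, hj⟩
      exact hp (Prod.ext (Fin.ext hi) (Fin.ext hj))
    · simp
  refine hF.pos_of_mul (p := Sum.inl (0, 0)) (q := Sum.inr (0, 0)) (0, 0) fun a b => ?_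
  refine (hev0 _ _).symm.trans ?_
  rw [hmul, Finset.sum_eq_single (0, 0), Finset.sum_eq_single (0, 0)]
  · simp [hone, mul_comm]
  · intro p _ hp; simp [hp]
  · simp
  · intro p _ hp; simp [hp]
  · simp

end CanonicalForm

/-! ## The structure of the two algebras -/

section Algebras

open Polynomial

variable (K : Type*) [Field K]

noncomputable def DerivAlg.x : DerivAlg K := RingQuot.mkAlgHom K (DerivRel K) (FreeAlgebra.ι K 0)

noncomputable def DerivAlg.d : DerivAlg K := RingQuot.mkAlgHom K (DerivRel K) (FreeAlgebra.ι K 1)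

noncomputable def EulerAlg.x : EulerAlg K := RingQuot.mkAlgHom K (EulerRel K) (FreeAlgebra.ι K 0)

noncomputable def EulerAlg.t : EulerAlg K := RingQuot.mkAlgHom K (EulerRel K) (FreeAlgebra.ι K 1)

theorem DerivAlg.d_mul_x : d K * x K = x K * d K + 1 := by
  have := RingQuot.mkAlgHom_rel K (DerivRel.comm (K := K))
  rwa [map_mul, map_add, map_mul, map_one] at this

theorem EulerAlg.t_mul_x : t K * x K = x K * (t K + 1) := by
  have := RingQuot.mkAlgHom_rel K (EulerRel.comm (K := K))
  rwa [map_mul, map_mul, map_add, map_one] at this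

theorem derivMulIn_iff {n L : ℕ} :
    DerivMulIn K n L ↔ FormMulIn K (DerivAlg.x K) (DerivAlg.d K) n L := Iff.rfl

theorem eulerMulIn_iff {n L : ℕ} :
    EulerMulIn K n L ↔ FormMulIn K (EulerAlg.x K) (EulerAlg.t K) n L := Iff.rfl

variable {K}

theorem DerivAlg.d_mul_x_pow (i : ℕ) : d K * x K ^ i = x K ^ i * d K + i * x K ^ (i - 1) := by
  induction i with
  | zero => simp
  | succ i ih =>
    rw [pow_succ, ← mul_assoc, ih, add_mul, mul_assoc, d_mul_x, Nat.add_sub_cancel, mul_assoc]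
    rcases i with _ | i
    · simp
    · rw [Nat.add_sub_cancel, ← pow_succ]
      push_cast
      noncomm_ring

theorem EulerAlg.t_mul_x_pow (i : ℕ) : t K * x K ^ i = x K ^ i * t K + i * x K ^ i := by
  induction i with
  | zero => simp
  | succ i ih =>
    rw [pow_succ, ← mul_assoc, ih, add_mul, mul_assoc, t_mul_x, mul_assoc]
    push_cast
    noncomm_ring

theorem DerivAlg.d_mul_monomial_mem (i j : ℕ) :
    d K * (x K ^ i * d K ^ j) ∈ bidegreeLE K (x K) (d K) i (j + 1) := by
  rw [← mul_assoc, d_mul_x_pow, add_mul, mul_assoc, ← pow_succ', mul_assoc, ← nsmul_eq_mul]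
  exact Submodule.add_mem _ (monomial_mem_bidegreeLE le_rfl le_rfl)
    (Submodule.smul_of_tower_mem _ _ (monomial_mem_bidegreeLE (by omega) (by omega)))

theorem EulerAlg.t_mul_monomial_mem (i j : ℕ) :
    t K * (x K ^ i * t K ^ j) ∈ bidegreeLE K (x K) (t K) i (j + 1) := by
  rw [← mul_assoc, t_mul_x_pow, add_mul, mul_assoc, ← pow_succ', mul_assoc, ← nsmul_eq_mul]
  exact Submodule.add_mem _ (monomial_mem_bidegreeLE le_rfl le_rfl)
    (Submodule.smul_of_tower_mem _ _ (monomial_mem_bidegreeLE (by omega) (by omega)))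

/-- The generic action of `K[X]⟨∂⟩` on `K[Y][X]`: `∂` acts as `d/dX + Y`. -/
noncomputable def DerivAlg.rep : DerivAlg K →ₐ[K] Module.End K K[X][X] :=
  RingQuot.liftAlgHom K ⟨FreeAlgebra.lift K ![LinearMap.mulLeft K (X : K[X][X]),
    (derivative (R := K[X])).restrictScalars K + LinearMap.mulLeft K (C X : K[X][X])], by
    rintro _ _ ⟨⟩
    ext1 f
    simp [derivative_mul]
    ring⟩

theorem DerivAlg.rep_x_pow_mul (i : ℕ) (a : DerivAlg K) :
    rep (x K ^ i * a) 1 = (X : K[X][X]) ^ i * rep a 1 := by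
  have hx : ∀ f : K[X][X], rep (x K) f = X * f := fun f => by simp [rep, x]
  induction i with
  | zero => simp
  | succ i ih =>
    rw [pow_succ', mul_assoc, map_mul, Module.End.mul_apply, ih, hx, pow_succ', mul_assoc]

/-- Applied to polynomials constant in `X`, the derivative part of `∂` vanishes and only
multiplication by `Y` remains. The extra variable separates the powers of `∂` in every
characteristic; on `K[X]` alone, `∂^p` is zero in characteristic `p`. -/
theorem DerivAlg.rep_monomial (i j : ℕ) :
    rep (x K ^ i * d K ^ j) 1 = (X : K[X][X]) ^ i * C (X ^ j) := by
  have hd : ∀ f : K[X], rep (d K) (C f) = C (X * f) := fun f => by simp [rep, d]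
  have hdj : rep (d K ^ j) 1 = (C (X ^ j) : K[X][X]) := by
    induction j with
    | zero => simp
    | succ j ih => rw [pow_succ', map_mul, Module.End.mul_apply, ih, hd, pow_succ']
  rw [rep_x_pow_mul, hdj]

/-- The coefficient on `X^i ∂^j`. -/
noncomputable def DerivAlg.coeff (i j : ℕ) : DerivAlg K →ₗ[K] K :=
  lcoeff K j ∘ₗ (lcoeff K[X] i).restrictScalars K ∘ₗ LinearMap.applyₗ (1 : K[X][X]) ∘ₗ
    (rep (K := K)).toLinearMap

theorem DerivAlg.coeff_monomial (i j k l : ℕ) :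
    coeff i j (x K ^ k * d K ^ l) = if i = k ∧ j = l then 1 else 0 := by
  have : coeff i j (x K ^ k * d K ^ l) = ((rep (x K ^ k * d K ^ l) 1).coeff i).coeff j := rfl
  rw [this, rep_monomial, coeff_mul_C, coeff_X_pow]
  by_cases h : i = k <;> simp [h, coeff_X_pow]

/-- This is how a left factor `X^c` is cancelled in the reduction from `∂` to `θ`. -/
theorem DerivAlg.coeff_x_pow_mul (c i j : ℕ) (a : DerivAlg K) :
    coeff (i + c) j (x K ^ c * a) = coeff i j a := by
  have h : ∀ k (b : DerivAlg K), coeff k j b = ((rep b 1).coeff k).coeff j := fun _ _ => rfl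
  rw [h, h, rep_x_pow_mul, coeff_X_pow_mul]

theorem DerivAlg.coeff_bform {a b i j : ℕ} (α : ℕ × ℕ → K) (hi : i < a) (hj : j < b) :
    coeff i j (bform (x K) (d K) a b α) = α (i, j) := by
  simp only [bform, map_sum, map_smul, coeff_monomial]
  rw [Finset.sum_eq_single i, Finset.sum_eq_single j]
  · simp
  · intro l _ hl; simp [hl.symm]
  · intro h; exact absurd (Finset.mem_range.2 hj) h
  · intro k _ hk; simp [hk.symm]
  · intro h; exact absurd (Finset.mem_range.2 hi) h

/-- The coefficient on `1`. -/
noncomputable def EulerAlg.constCoeff : EulerAlg K →ₐ[K] K :=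
  RingQuot.liftAlgHom K ⟨FreeAlgebra.lift K ![0, 0], by rintro _ _ ⟨⟩; simp⟩

theorem EulerAlg.constCoeff_monomial (i j : ℕ) :
    constCoeff (x K ^ i * t K ^ j) = if i = 0 ∧ j = 0 then 1 else 0 := by
  have hx : constCoeff (x K) = 0 := by simp [constCoeff, x]
  have ht : constCoeff (t K) = 0 := by simp [constCoeff, t]
  rw [map_mul, map_pow, map_pow, hx, ht]
  by_cases hi : i = 0 <;> by_cases hj : j = 0 <;> simp [hi, hj]

/-- For `n < 2` the term with the logarithm is zero, so the constant cost of a direct multiplication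
has to be paid by the cost function itself. -/
theorem DerivMulIn.pos {n L : ℕ} (h : DerivMulIn K n L) : 0 < L :=
  FormMulIn.pos ((derivMulIn_iff K).1 h) (DerivAlg.coeff 0 0) fun i j => by
    simp [DerivAlg.coeff_monomial, eq_comm]

theorem EulerMulIn.pos {n L : ℕ} (h : EulerMulIn K n L) : 0 < L :=
  FormMulIn.pos ((eulerMulIn_iff K).1 h) EulerAlg.constCoeff.toLinearMap
    EulerAlg.constCoeff_monomial

/-! ### Falling factorials of `X∂`. -/

/-- The embedding of `K[X]⟨θ⟩` into `K[X]⟨∂⟩`, which maps `θ` to `X ∂`. -/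
noncomputable def EulerAlg.toDeriv : EulerAlg K →ₐ[K] DerivAlg K :=
  RingQuot.liftAlgHom K ⟨FreeAlgebra.lift K ![DerivAlg.x K, DerivAlg.x K * DerivAlg.d K], by
    rintro _ _ ⟨⟩
    simp [mul_assoc, DerivAlg.d_mul_x]⟩

theorem EulerAlg.toDeriv_x : toDeriv (x K) = DerivAlg.x K := by simp [toDeriv, x]

theorem EulerAlg.toDeriv_t : toDeriv (t K) = DerivAlg.x K * DerivAlg.d K := by simp [toDeriv, t]

theorem DerivAlg.x_mul_d_mul_x_pow (n : ℕ) :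
    x K * d K * x K ^ n = x K ^ n * (x K * d K) + n * x K ^ n := by
  rw [mul_assoc, d_mul_x_pow]
  rcases n with _ | n
  · simp
  · rw [mul_add, ← mul_assoc, ← mul_assoc, Nat.add_sub_cancel, ← pow_succ',
      ← mul_assoc (x K ^ (n + 1)), ← pow_succ, (Nat.cast_commute (n + 1) (x K)).eq.symm, mul_assoc, ← pow_succ']

/-- The recurrence `X^k ∂^k (θ - k) = X^(k+1) ∂^(k+1)` of the falling factorials, without
subtraction. -/
theorem DerivAlg.x_pow_mul_d_pow_mul (k : ℕ) :
    x K ^ k * d K ^ k * (x K * d K) = x K ^ (k + 1) * d K ^ (k + 1) + k * (x K ^ k * d K ^ k) := by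
  have h : d K ^ k * x K = x K * d K ^ k + k * d K ^ (k - 1) := by
    induction k with
    | zero => simp
    | succ k ih =>
      rw [pow_succ', mul_assoc, ih, mul_add, ← mul_assoc, d_mul_x, add_mul, one_mul, mul_assoc,
        Nat.add_sub_cancel, ← mul_assoc (d K) (k : DerivAlg K), (Nat.cast_commute k (d K)).eq.symm,
        mul_assoc (k : DerivAlg K), add_assoc]
      rcases k with _ | k
      · simp
      · rw [Nat.add_sub_cancel, ← pow_succ' (d K) k]
        generalize d K ^ (k + 1) = w
        push_cast
        noncomm_ring
  rw [mul_assoc, ← mul_assoc (d K ^ k), h, add_mul, mul_add, pow_succ, mul_assoc, mul_assoc,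
    mul_assoc, pow_succ (d K)]
  congr 1
  rcases k with _ | k
  · simp
  · rw [Nat.add_sub_cancel, ← pow_succ, ← mul_assoc, ← mul_assoc,
      (Nat.cast_commute (k + 1) (x K ^ (k + 1))).eq]

/-- The Newton basis at `n, n + 1, …` evaluated at `θ = X ∂`. -/
theorem DerivAlg.aeval_newtonPoly_mul (n k : ℕ) :
    aeval (x K * d K) (newtonPoly (fun l => ((n + l : ℕ) : K)) k) * x K ^ n =
      x K ^ n * (x K ^ k * d K ^ k) := by
  induction k with
  | zero => simp [newtonPoly]
  | succ k ih =>
    have hshift : aeval (x K * d K) (X - C ((n + k : ℕ) : K)) * x K ^ n =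
        x K ^ n * (x K * d K - (k : DerivAlg K)) := by
      rw [map_sub, aeval_X, aeval_C, map_natCast, sub_mul, x_mul_d_mul_x_pow, mul_sub,
        (Nat.cast_commute k (x K ^ n)).eq.symm]
      push_cast
      noncomm_ring
    rw [newtonPoly_succ, map_mul, mul_assoc, hshift, ← mul_assoc, ih, mul_assoc, mul_sub,
      x_pow_mul_d_pow_mul, (Nat.cast_commute k (x K ^ k * d K ^ k)).eq.symm, add_sub_cancel_right]

theorem DerivAlg.aeval_newtonSum_mul (n N : ℕ) (e : ℕ → K) :
    aeval (x K * d K) (newtonSum (fun l => ((n + l : ℕ) : K)) N e) * x K ^ n =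
      x K ^ n * ∑ k ∈ Finset.range N, e k • (x K ^ k * d K ^ k) := by
  rw [newtonSum, map_sum, Finset.sum_mul, Finset.mul_sum]
  refine Finset.sum_congr rfl fun k _ => ?_
  rw [map_mul, aeval_C, mul_assoc, aeval_newtonPoly_mul, mul_smul_comm, Algebra.smul_def]

theorem DerivAlg.aeval_newtonSum (N : ℕ) (e : ℕ → K) :
    aeval (x K * d K) (newtonSum (fun l => (l : K)) N e) =
      ∑ k ∈ Finset.range N, e k • (x K ^ k * d K ^ k) := by
  simpa using aeval_newtonSum_mul 0 N e

theorem EulerAlg.toDeriv_bform (a b : ℕ) (α : ℕ × ℕ → K) :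
    toDeriv (bform (x K) (t K) a b α) = ∑ i ∈ Finset.range a,
      DerivAlg.x K ^ i * aeval (DerivAlg.x K * DerivAlg.d K) (truncPoly b fun j => α (i, j)) := by
  rw [bform_eq_sum_aeval, map_sum]
  refine Finset.sum_congr rfl fun i _ => ?_
  rw [map_mul, map_pow, toDeriv_x, ← aeval_algHom_apply, toDeriv_t]

end Algebras

/-! ## Changing the algebra -/

section Reductions

open Polynomial

/-! ### Index shifts between rows `X^i · X^k ∂^k` and monomials. -/

section Shear

variable {K : Type*} [Field K] {A : Type*} [Ring A] [Algebra K A]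

theorem sum_shift (f : ℕ → K) (g : ℕ → A) {N k D : ℕ} (h : N + k ≤ D) :
    ∑ i ∈ Finset.range N, f i • g (i + k) =
      ∑ a ∈ Finset.range D, (if k ≤ a ∧ a - k < N then f (a - k) else 0) • g a := by
  refine Finset.sum_bij_ne_zero (fun i _ _ => i + k) ?_ ?_ ?_ ?_
  · intro i hi _
    have := Finset.mem_range.1 hi
    exact Finset.mem_range.2 (by omega)
  · intro i _ _ j _ _ hij; omega
  · intro a _ hne
    by_cases hc : k ≤ a ∧ a - k < N
    · refine ⟨a - k, Finset.mem_range.2 hc.2, ?_, Nat.sub_add_cancel hc.1⟩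
      rwa [if_pos hc, ← Nat.sub_add_cancel hc.1, Nat.add_sub_cancel] at hne
    · rw [if_neg hc, zero_smul] at hne
      exact absurd rfl hne
  · intro i hi _
    rw [Nat.add_sub_cancel, if_pos ⟨Nat.le_add_left _ _, Finset.mem_range.1 hi⟩]

/-- The array `e (i, k)` moved to the positions `(i + k, k)`. -/
def shear (N m : ℕ) (e : ℕ × ℕ → K) (p : ℕ × ℕ) : K :=
  if p.2 ≤ p.1 ∧ p.1 - p.2 < N ∧ p.2 < m then e (p.1 - p.2, p.2) else 0

theorem bform_shear (x y : A) {N m D R : ℕ} (e : ℕ × ℕ → K) (hD : N + m ≤ D + 1) (hR : m ≤ R) :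
    bform x y D R (shear N m e) =
      ∑ i ∈ Finset.range N, x ^ i * ∑ k ∈ Finset.range m, e (i, k) • (x ^ k * y ^ k) := by
  simp only [Finset.mul_sum]
  rw [bform, Finset.sum_comm, Finset.sum_comm (s := Finset.range N)]
  refine (Finset.sum_subset (Finset.range_subset_range.2 hR) fun k _ hk => ?_).symm.trans ?_
  · refine Finset.sum_eq_zero fun a _ => ?_
    rw [shear, if_neg (fun h => hk (Finset.mem_range.2 h.2.2)), zero_smul]
  · refine Finset.sum_congr rfl fun k hk => ?_
    have hk' := Finset.mem_range.1 hk
    have := sum_shift (fun i => e (i, k)) (fun a => x ^ a * y ^ k) (N := N) (k := k) (D := D)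
      (by omega)
    simp only [shear, hk', and_true]
    rw [← this]
    refine Finset.sum_congr rfl fun i _ => ?_
    rw [mul_smul_comm, ← mul_assoc, pow_add]

/-- The array `α (i, j)` moved to the positions `(n + i - j, j)`. -/
def unshear (n : ℕ) (α : ℕ × ℕ → K) (p : ℕ × ℕ) : K :=
  if (n - p.2 ≤ p.1 ∧ p.1 - (n - p.2) < n + 1) ∧ p.2 < n + 1 then α (p.1 - (n - p.2), p.2) else 0

/-- `X^n X^i ∂^j = X^(n+i-j) (X^j ∂^j)`: since `j ≤ n`, the factor `X^n` supplies the powers of `X`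
needed to pair off every `∂`. -/
theorem pow_mul_bform (x y : A) {n N : ℕ} (hN : n + 1 ≤ N) (α : ℕ × ℕ → K) :
    x ^ n * bform x y (n + 1) (n + 1) α = ∑ m ∈ Finset.range (2 * n + 1),
      x ^ m * ∑ j ∈ Finset.range N, unshear n α (m, j) • (x ^ j * y ^ j) := by
  simp only [bform, Finset.mul_sum]
  rw [Finset.sum_comm, Finset.sum_comm (s := Finset.range (2 * n + 1))]
  refine Eq.trans ?_ (Finset.sum_subset (Finset.range_subset_range.2 hN) fun j _ hj => ?_)
  · refine Finset.sum_congr rfl fun j hj => ?_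
    have hj' := Finset.mem_range.1 hj
    have := sum_shift (fun i => α (i, j)) (fun a => x ^ a * (x ^ j * y ^ j)) (N := n + 1)
      (k := n - j) (D := 2 * n + 1) (by omega)
    simp only [unshear, hj', and_true, mul_smul_comm]
    rw [← this]
    refine Finset.sum_congr rfl fun i _ => ?_
    rw [← mul_assoc, ← mul_assoc, ← pow_add, ← pow_add]
    congr 3
    omega
  · refine Finset.sum_eq_zero fun a _ => ?_
    rw [unshear, if_neg (fun h => hj (Finset.mem_range.2 h.2)), zero_smul, mul_zero]

theorem SlpComputes.rows {R : (ℕ → K) → (ℕ → K)} {L : ℕ} (hR : SlpComputes R L) (N : ℕ) :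
    SlpComputes (fun (u : ℕ × ℕ → K) (p : ℕ × ℕ) =>
      if p.1 < N then R (fun j => u (p.1, j)) p.2 else 0) (N * L) := by
  have := SlpComputes.family (Finset.range N) (L := L)
    (F := fun i (u : ℕ × ℕ → K) k => if i < N then R (fun j => u (i, j)) k else 0)
    (fun i hi => (hR.precomp (fun (u : ℕ × ℕ → K) j => u (i, j))
      fun j => Or.inl ⟨(i, j), fun _ => rfl⟩).congr fun u k => if_pos (Finset.mem_range.1 hi))
    fun i hi k => Or.inr ⟨0, fun u => if_neg fun h => hi (Finset.mem_range.2 h)⟩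
  simpa using this

end Shear

variable {K : Type*} [Field K] {M : ℕ → ℕ}

theorem exists_newtonSum_eq_truncPoly_of_le (hM : ∀ n, PolyMulIn K n (M n)) (hS : SuperLinear M)
    {r t : ℕ} (hr : r ≤ 2 ^ t) (p : ℕ → K) :
    ∃ E : (ℕ → K) → (ℕ → K), SlpComputes E (3 * t * M (2 ^ t)) ∧
      ∀ u, newtonSum p (2 ^ t) (E u) = truncPoly r u := by
  obtain ⟨E, hE, hEu⟩ := exists_newtonSum_eq_truncPoly hM hS t p
  refine ⟨fun u => E fun j => if j < r then u j else 0, hE.precomp _ fun k => ?_, fun u => ?_⟩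
  · by_cases hk : k < r
    · exact Or.inl ⟨k, fun _ => if_pos hk⟩
    · exact Or.inr ⟨0, fun _ => if_neg hk⟩
  · rw [hEu]
    ext k
    simp only [coeff_truncPoly]
    split_ifs <;> first | rfl | omega

/-- Rowwise conversion of `K[X]⟨θ⟩` to the elements `X^(i+k) ∂^k`. -/
theorem EulerAlg.toDeriv_bform_eq_sum {E : (ℕ → K) → (ℕ → K)} {r N : ℕ}
    (hE : ∀ u, newtonSum (fun l => (l : K)) N (E u) = truncPoly r u) (a : ℕ) (α : ℕ × ℕ → K) :
    toDeriv (bform (x K) (t K) a r α) = ∑ i ∈ Finset.range a, DerivAlg.x K ^ i *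
      ∑ k ∈ Finset.range N, E (fun j => α (i, j)) k • (DerivAlg.x K ^ k * DerivAlg.d K ^ k) := by
  rw [toDeriv_bform]
  refine Finset.sum_congr rfl fun i _ => ?_
  rw [← hE, DerivAlg.aeval_newtonSum]

theorem DerivAlg.coeff_sheared {N m i k : ℕ} (e : ℕ × ℕ → K) (hi : i < N) (hk : k < m) :
    coeff (i + k) k (∑ i ∈ Finset.range N, x K ^ i *
      ∑ k ∈ Finset.range m, e (i, k) • (x K ^ k * d K ^ k)) = e (i, k) := by
  rw [← bform_shear (x K) (d K) (D := N + m) (R := m) e (by omega) le_rfl,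
    coeff_bform _ (by omega) hk, shear, Nat.add_sub_cancel, if_pos ⟨by omega, hi, hk⟩]

/-- Size `3n` suffices for the images: row `i ≤ n` has Newton indices `k < 2^t ≤ 2n`, so its
monomials `X^(i+k) ∂^k` have both exponents below `3n`. -/
theorem EulerMulIn.of_derivMulIn (hM : ∀ n, PolyMulIn K n (M n)) (hS : SuperLinear M)
    {n t L : ℕ} (ht : n < 2 ^ t) (ht' : 2 ^ t ≤ 2 * n) (hL : DerivMulIn K (3 * n) L) :
    EulerMulIn K n (2 * ((n + 1) * (3 * t * M (2 ^ t))) + L +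
      (2 * n + 1) * (3 * (t + 1) * M (2 ^ (t + 1)))) := by
  have ht1 : 2 ^ (t + 1) = 2 * 2 ^ t := pow_succ' _ _
  obtain ⟨F, hF, hFmul⟩ := formMulIn_iff.1 ((derivMulIn_iff K).1 hL)
  obtain ⟨E, hE, hEu⟩ := exists_newtonSum_eq_truncPoly_of_le hM hS (r := n + 1) ht fun l => (l : K)
  -- `E'` is not part of the program, and its cost is dropped. It only names the Newton coordinates
  -- of the rows of the product, to compare them with the entries of `P`.
  obtain ⟨E', -, hEu'⟩ := exists_newtonSum_eq_truncPoly_of_le hM hS (r := 2 * n + 1) (t := t + 1)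
    (by omega) fun l => (l : K)
  let T : (ℕ × ℕ → K) → (ℕ × ℕ → K) := fun α =>
    shear (n + 1) (2 ^ t) fun p => E (fun j => α (p.1, j)) p.2
  have hT : SlpComputes T ((n + 1) * (3 * t * M (2 ^ t))) := by
    refine (hE.rows (n + 1)).select T fun p => ?_
    by_cases hp : p.2 ≤ p.1 ∧ p.1 - p.2 < n + 1 ∧ p.2 < 2 ^ t
    · exact Or.inl ⟨(p.1 - p.2, p.2), fun u => (if_pos hp).trans (if_pos hp.2.1).symm⟩
    · exact Or.inr ⟨0, fun u => if_neg hp⟩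
  have hTspec : ∀ α, bform (DerivAlg.x K) (DerivAlg.d K) (3 * n + 1) (3 * n + 1) (T α) =
      EulerAlg.toDeriv (bform (EulerAlg.x K) (EulerAlg.t K) (n + 1) (n + 1) α) := fun α => by
    rw [bform_shear _ _ _ (by omega) (by omega), EulerAlg.toDeriv_bform_eq_sum hEu]
  let P : ((ℕ × ℕ) ⊕ (ℕ × ℕ) → K) → (ℕ × ℕ → K) := fun u =>
    F (Sum.elim (T fun p => u (Sum.inl p)) (T fun p => u (Sum.inr p)))
  have hP : SlpComputes P (2 * ((n + 1) * (3 * t * M (2 ^ t))) + L) := by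
    have h1 := hT.precomp (fun (u : (ℕ × ℕ) ⊕ (ℕ × ℕ) → K) p => u (Sum.inl p))
      fun k => Or.inl ⟨_, fun _ => rfl⟩
    have h2 := hT.precomp (fun (u : (ℕ × ℕ) ⊕ (ℕ × ℕ) → K) p => u (Sum.inr p))
      fun k => Or.inl ⟨_, fun _ => rfl⟩
    exact (hF.comp (h1.sumElim h2)).mono (by omega)
  have hG := ((newtonSum_computes hM hS (t + 1) fun l => (l : K)).rows (2 * n + 1)).precomp
    (fun (v : ℕ × ℕ → K) p => v (p.1 + p.2, p.2)) fun p => Or.inl ⟨(p.1 + p.2, p.2), fun _ => rfl⟩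
  refine (eulerMulIn_iff K).2 (formMulIn_iff.2 ⟨_, hG.comp hP, fun u => ?_⟩)
  obtain ⟨γ, hγ⟩ := exists_bform_mul (K := K) EulerAlg.t_mul_monomial_mem n
    (fun p => u (Sum.inl p)) (fun p => u (Sum.inr p))
  rw [hγ]
  have hPγ : bform (DerivAlg.x K) (DerivAlg.d K) (2 * (3 * n) + 1) (2 * (3 * n) + 1) (P u) =
      ∑ i ∈ Finset.range (2 * n + 1), DerivAlg.x K ^ i * ∑ k ∈ Finset.range (2 ^ (t + 1)),
        E' (fun j => γ (i, j)) k • (DerivAlg.x K ^ k * DerivAlg.d K ^ k) := by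
    rw [← EulerAlg.toDeriv_bform_eq_sum hEu', ← hγ, map_mul, ← hTspec, ← hTspec]
    exact hFmul _
  refine bform_congr _ _ fun i hi j hj => ?_
  -- Both sides are canonical forms in `K[X]⟨∂⟩`, so the entry of `P u` at `(i + k, k)` must be the
  -- `k`-th Newton coordinate of row `i`.
  have hrow : newtonSum (fun l => (l : K)) (2 ^ (t + 1)) (fun k => P u (i + k, k)) =
      truncPoly (2 * n + 1) fun j => γ (i, j) := by
    rw [← hEu']
    refine newtonSum_congr _ fun k hk => ?_
    rw [← DerivAlg.coeff_bform (a := 2 * (3 * n) + 1) (b := 2 * (3 * n) + 1) (P u)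
      (by omega) (by omega), hPγ]
    exact DerivAlg.coeff_sheared (fun p => E' (fun j => γ (p.1, j)) p.2) hi hk
  simp only [if_pos hi]
  rw [hrow, coeff_truncPoly, if_pos hj]

theorem DerivMulIn.of_eulerMulIn (hM : ∀ n, PolyMulIn K n (M n)) (hS : SuperLinear M)
    {n t L : ℕ} (ht : n < 2 ^ t) (ht' : 2 ^ t ≤ 2 * n) (hL : EulerMulIn K (2 * n) L) :
    DerivMulIn K n (2 * ((2 * n + 1) * (3 * t * M (2 ^ t))) + L +
      (4 * n + 1) * (3 * (t + 2) * M (2 ^ (t + 2)))) := by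
  have ht2 : 2 ^ (t + 2) = 4 * 2 ^ t := by rw [pow_add]; ring
  have h4 : 2 * (2 * n) + 1 = 4 * n + 1 := by ring
  obtain ⟨F, hF, hFmul⟩ := formMulIn_iff.1 ((eulerMulIn_iff K).1 hL)
  obtain ⟨E, hE, hEu⟩ := exists_newtonSum_eq_truncPoly_of_le hM hS (r := 4 * n + 1) (t := t + 2)
    (by omega) fun l => (l : K)
  -- The `θ`-form of `X^c (X^n a) X^(-c)`: moving `X^c` past `θ` shifts the Newton nodes by `c`.
  let T : ℕ → (ℕ × ℕ → K) → (ℕ × ℕ → K) := fun c α p => if p.1 < 2 * n + 1 then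
    (newtonSum (fun l => ((c + l : ℕ) : K)) (2 ^ t) fun j => unshear n α (p.1, j)).coeff p.2 else 0
  have hT : ∀ c, SlpComputes (T c) ((2 * n + 1) * (3 * t * M (2 ^ t))) := fun c =>
    ((newtonSum_computes hM hS t fun l => ((c + l : ℕ) : K)).rows (2 * n + 1)).precomp
      (unshear n) fun p => by
        by_cases hp : (n - p.2 ≤ p.1 ∧ p.1 - (n - p.2) < n + 1) ∧ p.2 < n + 1
        · exact Or.inl ⟨_, fun u => if_pos hp⟩
        · exact Or.inr ⟨0, fun u => if_neg hp⟩
  have hTspec : ∀ c α,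
      EulerAlg.toDeriv (bform (EulerAlg.x K) (EulerAlg.t K) (2 * n + 1) (2 * n + 1) (T c α)) *
        DerivAlg.x K ^ c = DerivAlg.x K ^ c * (DerivAlg.x K ^ n *
          bform (DerivAlg.x K) (DerivAlg.d K) (n + 1) (n + 1) α) := fun c α => by
    rw [EulerAlg.toDeriv_bform, pow_mul_bform _ _ ht, Finset.mul_sum, Finset.sum_mul]
    refine Finset.sum_congr rfl fun m hm => ?_
    simp only [T, if_pos (Finset.mem_range.1 hm)]
    rw [truncPoly_coeff, mul_assoc, DerivAlg.aeval_newtonSum_mul, ← mul_assoc, ← mul_assoc,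
      ← pow_add, ← pow_add, add_comm]
    exact (newtonSum_degree_lt _ _ _).trans_le (by exact_mod_cast (by omega : 2 ^ t ≤ 2 * n + 1))
  -- With `c = n` on the left and `c = 0` on the right, the images multiply to `(A X^n) b = X^(2n) a
  -- b`.
  let P : ((ℕ × ℕ) ⊕ (ℕ × ℕ) → K) → (ℕ × ℕ → K) := fun u =>
    F (Sum.elim (T n fun p => u (Sum.inl p)) (T 0 fun p => u (Sum.inr p)))
  have hP : SlpComputes P (2 * ((2 * n + 1) * (3 * t * M (2 ^ t))) + L) := by
    have h1 := (hT n).precomp (fun (u : (ℕ × ℕ) ⊕ (ℕ × ℕ) → K) p => u (Sum.inl p))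
      fun k => Or.inl ⟨_, fun _ => rfl⟩
    have h2 := (hT 0).precomp (fun (u : (ℕ × ℕ) ⊕ (ℕ × ℕ) → K) p => u (Sum.inr p))
      fun k => Or.inl ⟨_, fun _ => rfl⟩
    exact (hF.comp (h1.sumElim h2)).mono (by omega)
  have hG : SlpComputes (fun (v : ℕ × ℕ → K) (p : ℕ × ℕ) =>
      if 2 * n + p.1 - p.2 < 4 * n + 1 then E (fun j => v (2 * n + p.1 - p.2, j)) p.2 else 0)
      ((4 * n + 1) * (3 * (t + 2) * M (2 ^ (t + 2)))) :=
    (hE.rows (4 * n + 1)).select _ fun p => Or.inl ⟨(2 * n + p.1 - p.2, p.2), fun _ => rfl⟩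
  refine (derivMulIn_iff K).2 (formMulIn_iff.2 ⟨_, hG.comp hP, fun u => ?_⟩)
  obtain ⟨γ, hγ⟩ := exists_bform_mul (K := K) DerivAlg.d_mul_monomial_mem n
    (fun p => u (Sum.inl p)) (fun p => u (Sum.inr p))
  rw [hγ]
  have hprod : DerivAlg.x K ^ (2 * n) *
      bform (DerivAlg.x K) (DerivAlg.d K) (2 * n + 1) (2 * n + 1) γ =
      ∑ m ∈ Finset.range (4 * n + 1), DerivAlg.x K ^ m * ∑ k ∈ Finset.range (2 ^ (t + 2)),
        E (fun j => P u (m, j)) k • (DerivAlg.x K ^ k * DerivAlg.d K ^ k) := by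
    have h0 := hTspec 0 fun p => u (Sum.inr p)
    have hn := hTspec n fun p => u (Sum.inl p)
    rw [pow_zero, mul_one, one_mul] at h0
    have hm := congrArg EulerAlg.toDeriv
      (hFmul (Sum.elim (T n fun p => u (Sum.inl p)) (T 0 fun p => u (Sum.inr p))))
    simp only [Sum.elim_inl, Sum.elim_inr, h4] at hm
    rw [map_mul, h0, ← mul_assoc, hn] at hm
    rw [← EulerAlg.toDeriv_bform_eq_sum hEu, ← hγ]
    refine Eq.trans ?_ hm.symm
    rw [two_mul, pow_add]
    simp only [mul_assoc]
  refine bform_congr _ _ fun i hi j hj => ?_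
  -- The coefficient on `X^(2n+i) ∂^j` comes from the `j`-th Newton coordinate of row `2n + i - j`;
  -- the subtraction is exact as `j ≤ 2n`.
  have hlhs : DerivAlg.coeff (2 * n + i - j + j) j (DerivAlg.x K ^ (2 * n) *
      bform (DerivAlg.x K) (DerivAlg.d K) (2 * n + 1) (2 * n + 1) γ) = γ (i, j) := by
    rw [Nat.sub_add_cancel (by omega), add_comm, DerivAlg.coeff_x_pow_mul,
      DerivAlg.coeff_bform _ hi hj]
  rw [hprod] at hlhs
  rw [if_pos (by omega : 2 * n + i - j < 4 * n + 1)]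
  refine Eq.trans ?_ hlhs
  exact (DerivAlg.coeff_sheared (fun p => E (fun j => P u (p.1, j)) p.2)
    (by omega : 2 * n + i - j < 4 * n + 1) (by omega : j < 2 ^ (t + 2))).symm

end Reductions

/-! ## The cost bounds -/

theorem log_bound {n : ℕ} (hn : 2 ≤ n) : ((Nat.log 2 n + 3 : ℕ) : ℝ) ≤ 6 * Real.log n := by
  have h2 : Real.log 2 ≤ Real.log n := Real.log_le_log (by norm_num) (by exact_mod_cast hn)
  have hpow : ((2 : ℝ) ^ Nat.log 2 n) ≤ n := by
    exact_mod_cast Nat.pow_log_le_self 2 (by omega : n ≠ 0)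
  have h := Real.log_le_log (by positivity) hpow
  rw [Real.log_pow] at h
  have := Real.log_two_gt_d9
  push_cast
  nlinarith [(Nat.cast_nonneg (Nat.log 2 n) : (0 : ℝ) ≤ _)]

/-- The total cost of a reduction whose conversions are made at the sizes `2^t`, `2^s`. -/
theorem reduction_cost_le {κ M : ℕ → ℕ} (hS : SuperLinear M) (hκ : ScalesBy κ M) {n t s : ℕ}
    (hn : 2 ≤ n) (hts : t ≤ s) (hs : s ≤ Nat.log 2 n + 3) {a b L c C : ℕ} (ha : a ≤ 2 * n + 1)
    (hb : b ≤ 4 * n + 1) (hL : L ≤ c * C) :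
    ((2 * (a * (3 * t * M (2 ^ t))) + L + b * (3 * s * M (2 ^ s)) : ℕ) : ℝ) ≤
      (c + 180 * κ 8) * (C + n * M n * Real.log n) := by
  have hM : ∀ r ≤ Nat.log 2 n + 3, M (2 ^ r) ≤ κ 8 * M n := fun r hr => by
    refine (hS.mono (by positivity) ?_).trans (hκ 8 (by norm_num) n)
    calc 2 ^ r ≤ 2 ^ (Nat.log 2 n + 3) := Nat.pow_le_pow_right (by norm_num) hr
      _ = 8 * 2 ^ Nat.log 2 n := by rw [pow_add]; ring
      _ ≤ 8 * n := Nat.mul_le_mul_left _ (Nat.pow_log_le_self 2 (by omega))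
  set l := Nat.log 2 n + 3 with hl
  have h1 : a * (3 * t * M (2 ^ t)) ≤ (2 * n + 1) * (3 * l * (κ 8 * M n)) := by
    gcongr
    · exact hts.trans hs
    · exact hM t (hts.trans hs)
  have h2 : b * (3 * s * M (2 ^ s)) ≤ (4 * n + 1) * (3 * l * (κ 8 * M n)) := by
    gcongr
    exact hM s hs
  -- Two conversions of at most `2n + 1` rows and one of at most `4n + 1` make `8n + 3` rows.
  have h3 : (8 * n + 3) * (3 * l * (κ 8 * M n)) ≤ 10 * n * (3 * l * (κ 8 * M n)) :=
    Nat.mul_le_mul_right _ (by omega)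
  have h4 : 2 * (a * (3 * t * M (2 ^ t))) + L + b * (3 * s * M (2 ^ s)) ≤
      c * C + 30 * (n * (κ 8 * M n)) * l := by
    linarith
  have h5 : ((2 * (a * (3 * t * M (2 ^ t))) + L + b * (3 * s * M (2 ^ s)) : ℕ) : ℝ) ≤
      c * C + 30 * (n * (κ 8 * M n)) * (l : ℕ) := by exact_mod_cast h4
  have h6 : 30 * ((n : ℝ) * (κ 8 * M n)) * (l : ℕ) ≤
      30 * ((n : ℝ) * (κ 8 * M n)) * (6 * Real.log n) :=
    mul_le_mul_of_nonneg_left (log_bound hn) (by positivity)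
  have hlog : 0 ≤ Real.log n := Real.log_natCast_nonneg n
  have h7 : 0 ≤ (c : ℝ) * (n * M n * Real.log n) := by positivity
  have h8 : 0 ≤ (κ 8 : ℝ) * C := by positivity
  linarith

theorem structure_constants_cost_le {n C : ℕ} (hn : n < 2) (hC : 0 < C) {c : ℝ} (hc : 432 ≤ c)
    (M : ℕ) : (((2 * n + 1) ^ 2 * (3 * (n + 1) ^ 4) : ℕ) : ℝ) ≤
      c * (C + n * M * Real.log n) := by
  have h : (2 * n + 1) ^ 2 * (3 * (n + 1) ^ 4) ≤ 432 := by interval_cases n <;> norm_num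
  have h' : (((2 * n + 1) ^ 2 * (3 * (n + 1) ^ 4) : ℕ) : ℝ) ≤ 432 := by exact_mod_cast h
  have hC' : (1 : ℝ) ≤ C := by exact_mod_cast hC
  have hlog : 0 ≤ (n : ℝ) * M * Real.log n :=
    mul_nonneg (by positivity) (Real.log_natCast_nonneg n)
  nlinarith

theorem mainTheorem2 (κ : ℕ → ℕ) :
    ∃ C : ℝ, 0 < C ∧
      ∀ (K : Type*) [Field K] (M : ℕ → ℕ),
        (∀ n, PolyMulIn K n (M n)) → SuperLinear M → ScalesBy κ M →
        (∀ Cd : ℕ → ℕ, (∀ n, DerivMulIn K n (Cd n)) → SuperLinear Cd → ScalesBy κ Cd →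
          ∀ n : ℕ, ∃ L : ℕ, EulerMulIn K n L ∧
            (L : ℝ) ≤ C * ((Cd n : ℝ) + (n : ℝ) * (M n : ℝ) * Real.log (n : ℝ))) ∧
        (∀ Ct : ℕ → ℕ, (∀ n, EulerMulIn K n (Ct n)) → SuperLinear Ct → ScalesBy κ Ct →
          ∀ n : ℕ, ∃ L : ℕ, DerivMulIn K n L ∧
            (L : ℝ) ≤ C * ((Ct n : ℝ) + (n : ℝ) * (M n : ℝ) * Real.log (n : ℝ))) := by
  -- 432 covers `n < 2`; `κ 3` and `κ 2` pay for the products of size `3n` and `2n`; `180 * κ 8`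
  -- pays for the conversions, of size at most `8n`, with `180 = 30 * 6` and 6 from `log_bound`.
  refine ⟨432 + κ 2 + κ 3 + 180 * κ 8, by positivity, ?_⟩
  intro K _ M hM hS hκ
  have hκ2 : (0 : ℝ) ≤ κ 2 := Nat.cast_nonneg _
  have hκ3 : (0 : ℝ) ≤ κ 3 := Nat.cast_nonneg _
  have hκ8 : (0 : ℝ) ≤ κ 8 := Nat.cast_nonneg _
  have hsize : ∀ {n : ℕ}, 2 ≤ n →
      n < 2 ^ (Nat.log 2 n + 1) ∧ 2 ^ (Nat.log 2 n + 1) ≤ 2 * n := fun {n} hn =>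
    ⟨Nat.lt_pow_succ_log_self (by norm_num) n, by
      rw [pow_succ']
      exact Nat.mul_le_mul_left _ (Nat.pow_log_le_self 2 (by omega))⟩
  have hnonneg : ∀ C n : ℕ, 0 ≤ (C : ℝ) + (n : ℝ) * (M n : ℝ) * Real.log n := fun C n =>
    add_nonneg (Nat.cast_nonneg _) (mul_nonneg (by positivity) (Real.log_natCast_nonneg n))
  refine ⟨fun Cd hCd _ hκd n => ?_, fun Ct hCt _ hκt n => ?_⟩
  · rcases lt_or_ge n 2 with hn | hn
    · exact ⟨_, formMulIn_structure_constants EulerAlg.t_mul_monomial_mem n,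
        structure_constants_cost_le hn (hCd n).pos (by linarith) _⟩
    · refine ⟨_, EulerMulIn.of_derivMulIn hM hS (hsize hn).1 (hsize hn).2 (hCd (3 * n)),
        (reduction_cost_le hS hκ hn (by omega) (by omega) (by omega) (by omega)
          (hκd 3 (by norm_num) n)).trans (mul_le_mul_of_nonneg_right ?_ (hnonneg _ _))⟩
      linarith
  · rcases lt_or_ge n 2 with hn | hn
    · exact ⟨_, formMulIn_structure_constants DerivAlg.d_mul_monomial_mem n,
        structure_constants_cost_le hn (hCt n).pos (by linarith) _⟩
    · refine ⟨_, DerivMulIn.of_eulerMulIn hM hS (hsize hn).1 (hsize hn).2 (hCt (2 * n)),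
        (reduction_cost_le hS hκ hn (by omega) (by omega) (by omega) (by omega)
          (hκt 2 (by norm_num) n)).trans (mul_le_mul_of_nonneg_right ?_ (hnonneg _ _))⟩
      linarith
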